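/- **Theorem 4.2.** Let $\Omega=[-\pi,\pi]^2$ be the two-dimensional torus (all functions are $2\pi$-periodic in both variables), with $(f,g)=\int_\Omega f\bar g\,dx$, $\|f\|=(f,f)^{1/2}$ and $\hat f(k)=(2\pi)^{-2}\int_\Omega f(x)e^{-ik\cdot x}\,dx$ for $k\in\mathbb Z^2$. For $s\ge 0$ let $H^s_{\rm per}(\Omega)$ be the space of $f\in L^2_{\rm per}(\Omega)$ with $\|f\|_s^2=\sum_{k}(1+|k|^2)^s|\hat f(k)|^2<\infty$, and let $|f|_s^2=\sum_{k}|k|^{2s}|\hat f(k)|^2$ (with $0^0=1$). Let $\mathbb X_N=\mathrm{span}_{\mathbb C}\{e^{ik\cdot x}:\max(|k_1|,|k_2|)\le N\}$ and $(-\Delta)^{\alpha/2}f=\sum_k|k|^\alpha\hat f(k)e^{ik\cdot x}$. Let $\alpha\in[1,2]$, let $u$ be a real-valued periodic $C^1$ function, and let $K>\tfrac12\|\partial_{x_1}u\|_{L^\infty(\Omega)}$. For a complex-valued $w\in L^2_{\rm per}(\Omega)$ and an integer $N\ge 1$, the modified projection $\widetilde\Pi_N w$ is the element of $\mathbb X_N$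 satisfying $$\big(K(\widetilde\Pi_N w-w)+u\,\partial_{x_1}(\widetilde\Pi_N w-w)-(-\Delta)^{\alpha/2}\partial_{x_1}(\widetilde\Pi_N w-w),\,v\big)=0\qquad\text{for all }v\in\mathbb X_N ,$$ where the derivatives of $e=\widetilde\Pi_N w-w$ are taken in the sense of periodic distributions, i.e. $(u\,\partial_{x_1}e,v)=-(e,\partial_{x_1}(uv))$ and $((-\Delta)^{\alpha/2}\partial_{x_1}e,v)=-(e,(-\Delta)^{\alpha/2}\partial_{x_1}v)$. Then: 1. $\widetilde\Pi_N w$ exists and is unique for every $w\in L^2_{\rm per}(\Omega)$ and every $N\ge1$. 2. If $r\ge0$ and $0\le l\le\min\{r,\alpha+1\}$, there is a constant $C>0$, independent of $N$ and $w$, such that for all $w\in H^r_{\rm per}(\Omega)$ and all $N\ge1$, $w-\widetilde\Pi_Nw\in H^l_{\rm per}(\Omega)$ and $$\|w-\widetilde\Pi_N w\|_l\le C\,N^{l-r}\,|w|_r .$$ 3. If $u$ and $w$ are real-analytic periodic functions, there are constants $C,\sigma>0$ independent of $N$ such that for all $N\ge1$, $$\|w-\widetilde\Pi_N w\|\le C\,e^{-\sigma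 N}\,\|w\| .$$ -/

import Mathlib

namespace FZK

noncomputable section

/-- The period cell `Ω = [-π, π]²` of the two-dimensional torus. -/
def Ω : Set (ℝ × ℝ) := Set.Icc (-Real.pi) Real.pi ×ˢ Set.Icc (-Real.pi) Real.pi

/-- `2π`-periodicity in both variables; functions on the torus are periodic functions on `ℝ²`. -/
def IsPeriodic {E : Type*} (f : ℝ × ℝ → E) : Prop :=
  ∀ x : ℝ × ℝ, f (x.1 + 2 * Real.pi, x.2) = f x ∧ f (x.1, x.2 + 2 * Real.pi) = f x

/-- The Fourier mode `x ↦ exp (i k · x)`. -/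
def expMode (k : ℤ × ℤ) (x : ℝ × ℝ) : ℂ :=
  Complex.exp (Complex.I * ((k.1 : ℂ) * (x.1 : ℂ) + (k.2 : ℂ) * (x.2 : ℂ)))

/-- The Euclidean length `|k|` of a wave vector. -/
def freqNorm (k : ℤ × ℤ) : ℝ := Real.sqrt ((k.1 : ℝ) ^ 2 + (k.2 : ℝ) ^ 2)

/-- The `L²` inner product `(f, g) = ∫_Ω f(x) conj(g(x)) dx`. -/
def ip (f g : ℝ × ℝ → ℂ) : ℂ := ∫ x in Ω, f x * (starRingEnd ℂ) (g x)

/-- The `L²` norm on `Ω`. -/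
def l2Norm (f : ℝ × ℝ → ℂ) : ℝ := Real.sqrt (∫ x in Ω, ‖f x‖ ^ 2)

/-- The Fourier coefficient `(2π)⁻² ∫_Ω f(x) exp (-i k · x) dx`. -/
def fourierCoef (f : ℝ × ℝ → ℂ) (k : ℤ × ℤ) : ℂ :=
  ((2 * (Real.pi : ℂ)) ^ 2)⁻¹ *
    ∫ x in Ω, f x *
      Complex.exp (-(Complex.I * ((k.1 : ℂ) * (x.1 : ℂ) + (k.2 : ℂ) * (x.2 : ℂ))))

/-- Membership in the periodic Sobolev space `H^s_per(Ω)`, `s ≥ 0`. -/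
def MemHper (s : ℝ) (f : ℝ × ℝ → ℂ) : Prop :=
  IsPeriodic f ∧ MeasureTheory.MemLp f 2 (MeasureTheory.volume.restrict Ω) ∧
    Summable fun k : ℤ × ℤ => (1 + freqNorm k ^ 2) ^ s * ‖fourierCoef f k‖ ^ 2

/-- The Sobolev norm `‖f‖_s`. -/
def sobolevNorm (s : ℝ) (f : ℝ × ℝ → ℂ) : ℝ :=
  Real.sqrt (∑' k : ℤ × ℤ, (1 + freqNorm k ^ 2) ^ s * ‖fourierCoef f k‖ ^ 2)

/-- The Sobolev seminorm `|f|_s`, that is `(∑ |k|^{2s} |f̂(k)|²)^{1/2}`. -/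
def sobolevSeminorm (s : ℝ) (f : ℝ × ℝ → ℂ) : ℝ :=
  Real.sqrt (∑' k : ℤ × ℤ, freqNorm k ^ (2 * s) * ‖fourierCoef f k‖ ^ 2)

/-- The space `X_N` of trigonometric polynomials with frequencies `max (|k₁|, |k₂|) ≤ N`. -/
def trigSpace (N : ℕ) : Submodule ℂ (ℝ × ℝ → ℂ) :=
  Submodule.span ℂ (expMode '' {k : ℤ × ℤ | max |k.1| |k.2| ≤ (N : ℤ)})

/-- The partial derivative `∂_{x₁}`. -/
def dx1 {E : Type*} [NormedAddCommGroup E] [NormedSpace ℝ E] (f : ℝ × ℝ → E) (x : ℝ × ℝ) : E :=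
  fderiv ℝ f x (1, 0)

/-- The spectral fractional Laplacian `(-Δ)^{α/2} f = ∑ |k|^α f̂(k) exp (i k · x)`. -/
def fracLap (α : ℝ) (f : ℝ × ℝ → ℂ) (x : ℝ × ℝ) : ℂ :=
  ∑' k : ℤ × ℤ, ((freqNorm k ^ α : ℝ) : ℂ) * fourierCoef f k * expMode k x

/-- The pairing `(K e + u ∂_{x₁} e - (-Δ)^{α/2} ∂_{x₁} e, v)` of a merely square-integrable periodic
`e` with a smooth periodic `v`. As `e` need not be differentiable, its derivatives are those of
distributions: `u` is real, `∂_{x₁}` is skew-adjoint and `(-Δ)^{α/2}` is self-adjoint, hence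
`(u ∂_{x₁} e, v) = -(e, ∂_{x₁}(u v))` and
`((-Δ)^{α/2} ∂_{x₁} e, v) = -(e, (-Δ)^{α/2} ∂_{x₁} v)`. -/
def pairing (α K : ℝ) (u : ℝ × ℝ → ℝ) (e v : ℝ × ℝ → ℂ) : ℂ :=
  (K : ℂ) * ip e v - ip e (dx1 fun x => (u x : ℂ) * v x) + ip e (fracLap α (dx1 v))

/-- `φ` is a modified projection of `w`: it lies in `X_N`, and
`(K (φ - w) + u ∂_{x₁}(φ - w) - (-Δ)^{α/2} ∂_{x₁}(φ - w), v) = 0` for all `v ∈ X_N`. -/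
def IsModifiedProjection (α K : ℝ) (u : ℝ × ℝ → ℝ) (N : ℕ) (w φ : ℝ × ℝ → ℂ) : Prop :=
  φ ∈ trigSpace N ∧ ∀ v ∈ trigSpace N, pairing α K u (φ - w) v = 0

end

end FZK

/-! Let `P` be the Fourier truncation of `w`, `f = w - P` and `θ = φ - P`, which lies in `X_N`.
Testing the defining equation with `v ∈ X_N` gives the same pairing for `θ` as for `f`. Since `f` is
orthogonal to `X_N` and Fourier multipliers preserve `X_N`, only the term `-(f, ∂₁(u v))` survives
on the right. It puts one derivative on `v`, which coercivity in `L²` alone cannot absorb.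

Two test functions close the estimate. Taking `v = θ` gives `L²` coercivity, because the dispersive
term is skew and integrating by parts in the transport term costs at most half of `sup |∂₁u|`.
Taking `v` to be the Hilbert transform of `θ` in `x₁` makes the dispersive term at least `‖∂₁θ‖²`,
because `α ≥ 1`. Together they give `‖θ‖ ≤ C ‖f‖` uniformly in `N` (`exists_stability_const`).

All three claims follow. With `f = 0` the square Galerkin system is injective, hence solvable. For
the algebraic rate, frequencies inside the box lose at most a factor `N^l` on the `L²` estimate, and
outside the box the error has the coefficients of `w` itself. For analytic `w`, Cauchy estimates
make the Fourier coefficients, hence `f`, exponentially small (`exists_decay`). -/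

open MeasureTheory Set

namespace FZK

/-! ### Parseval's identity on the cell, transported from the unit torus. -/

/-- The representative in `(-π, π]` of a point of the circle `ℝ / ℤ`, rescaled by `2π`. -/
noncomputable def circleLift (t : UnitAddCircle) : ℝ :=
  (2 * Real.pi) * (AddCircle.equivIoc 1 (-1 / 2) t : ℝ)

/-- Haar measure on `ℝ / ℤ` is Lebesgue measure on a half-open unit interval, and dilation by `2π`
divides the pushed-forward density by `2π`. -/
theorem measurePreserving_circleLift :
    MeasurePreserving circleLift AddCircle.haarAddCircle
      (ENNReal.ofReal (2 * Real.pi)⁻¹ • volume.restrict (Ioc (-Real.pi) Real.pi)) := by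
  have hpi := Real.pi_pos
  have h1 : MeasurePreserving (fun t : UnitAddCircle => (AddCircle.equivIoc 1 (-1 / 2) t : ℝ))
      AddCircle.haarAddCircle (volume.restrict (Ioc (-1 / 2 : ℝ) (-1 / 2 + 1))) := by
    have := (measurePreserving_subtype_coe (μa := volume)
      (measurableSet_Ioc (a := (-1 / 2 : ℝ)) (b := -1 / 2 + 1))).comp
        (AddCircle.measurePreserving_equivIoc 1 (a := -1 / 2))
    rw [AddCircle.volume_eq_smul_haarAddCircle] at this
    simpa using! this
  have h2 : MeasurePreserving (fun x : ℝ => (2 * Real.pi) * x) volume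
      (ENNReal.ofReal (2 * Real.pi)⁻¹ • volume) := by
    refine ⟨by fun_prop, ?_⟩
    rw [Real.map_volume_mul_left (by positivity), abs_of_pos (by positivity)]
  have h3 := h2.restrict_preimage (measurableSet_Ioc (a := -Real.pi) (b := Real.pi))
  have h4 : (fun x : ℝ => (2 * Real.pi) * x) ⁻¹' (Ioc (-Real.pi) Real.pi)
      = Ioc (-1 / 2 : ℝ) (-1 / 2 + 1) := by
    ext x
    simp only [mem_preimage, mem_Ioc]
    constructor
    · rintro ⟨h, h'⟩
      constructor <;> by_contra! hc <;> nlinarith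
    · rintro ⟨h, h'⟩
      constructor <;> nlinarith
  rw [h4, Measure.restrict_smul] at h3
  exact h3.comp h1

theorem fourier_eq_exp_circleLift (n : ℤ) (t : UnitAddCircle) :
    fourier n t = Complex.exp (Complex.I * ((n : ℂ) * (circleLift t : ℂ))) := by
  have ht : t = ((AddCircle.equivIoc 1 (-1 / 2) t : ℝ) : UnitAddCircle) :=
    ((AddCircle.equivIoc 1 (-1 / 2)).symm_apply_apply t).symm
  conv_lhs => rw [ht, fourier_coe_apply]
  congr 1
  simp only [circleLift]
  push_cast
  ring

theorem restrict_Ω_eq :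
    volume.restrict Ω = (volume.restrict (Ioc (-Real.pi) Real.pi)).prod
      (volume.restrict (Ioc (-Real.pi) Real.pi)) := by
  rw [Ω, Measure.volume_eq_prod, ← Measure.prod_restrict, restrict_Ioc_eq_restrict_Icc]

instance : IsFiniteMeasure (volume.restrict Ω) := by
  rw [restrict_Ω_eq]; infer_instance

/-- The rescaled representative in `(-π, π]²` of a point of the torus `(ℝ / ℤ)²`. -/
noncomputable def torusLift (t : UnitAddTorus (Fin 2)) : ℝ × ℝ :=
  (circleLift (t 0), circleLift (t 1))

theorem measurePreserving_torusLift :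
    MeasurePreserving torusLift (Measure.pi fun _ => AddCircle.haarAddCircle)
      (ENNReal.ofReal ((2 * Real.pi) ^ 2)⁻¹ • volume.restrict Ω) := by
  have h := (measurePreserving_circleLift.prod measurePreserving_circleLift).comp
    (measurePreserving_finTwoArrow (AddCircle.haarAddCircle (T := 1)))
  rw [Measure.prod_smul_left, Measure.prod_smul_right, smul_smul, ← restrict_Ω_eq,
    ← ENNReal.ofReal_mul (by positivity), ← mul_inv, ← sq] at h
  exact h

theorem integral_comp_torusLift {E : Type*} [NormedAddCommGroup E] [NormedSpace ℝ E]
    {g : ℝ × ℝ → E} (hg : AEStronglyMeasurable g (volume.restrict Ω)) :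
    ∫ t, g (torusLift t) ∂(Measure.pi fun _ : Fin 2 => AddCircle.haarAddCircle (T := 1))
      = ((2 * Real.pi) ^ 2)⁻¹ • ∫ x in Ω, g x := by
  have h := integral_map (f := g) measurePreserving_torusLift.aemeasurable
    (by rw [measurePreserving_torusLift.map_eq]; exact hg.smul_measure _)
  rw [measurePreserving_torusLift.map_eq, integral_smul_measure,
    ENNReal.toReal_ofReal (by positivity)] at h
  exact h.symm

theorem mFourierCoeff_comp_torusLift (f : ℝ × ℝ → ℂ)
    (hf : AEStronglyMeasurable f (volume.restrict Ω)) (n : Fin 2 → ℤ) :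
    UnitAddTorus.mFourierCoeff (f ∘ torusLift) n = fourierCoef f (n 0, n 1) := by
  have h1 : UnitAddTorus.mFourierCoeff (f ∘ torusLift) n =
      ∫ t : UnitAddTorus (Fin 2), (fun x : ℝ × ℝ => f x *
      Complex.exp (-(Complex.I * (((n 0 : ℤ) : ℂ) * (x.1 : ℂ) + ((n 1 : ℤ) : ℂ) * (x.2 : ℂ)))))
        (torusLift t) ∂(Measure.pi fun _ => AddCircle.haarAddCircle) := by
    refine integral_congr_ae (Filter.Eventually.of_forall fun t => ?_)
    simp only [UnitAddTorus.mFourier, ContinuousMap.coe_mk, Fin.prod_univ_two,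
      fourier_eq_exp_circleLift, Function.comp, smul_eq_mul, torusLift, ← Complex.exp_add]
    rw [mul_comm]
    congr 2
    push_cast [Pi.neg_apply]
    ring
  rw [h1]
  have hc : Continuous fun x : ℝ × ℝ => Complex.exp (-(Complex.I *
      (((n 0 : ℤ) : ℂ) * (x.1 : ℂ) + ((n 1 : ℤ) : ℂ) * (x.2 : ℂ)))) := by fun_prop
  refine (integral_comp_torusLift (hf.mul hc.aestronglyMeasurable)).trans ?_
  rw [fourierCoef, Complex.real_smul]
  push_cast
  rfl

/-- **Parseval's identity** on the period cell. -/
theorem hasSum_sq_fourierCoef {f : ℝ × ℝ → ℂ} (hf : MemLp f 2 (volume.restrict Ω)) :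
    HasSum (fun k => ‖fourierCoef f k‖ ^ 2) (((2 * Real.pi) ^ 2)⁻¹ * ∫ x in Ω, ‖f x‖ ^ 2) := by
  have hc : (ENNReal.ofReal ((2 * Real.pi) ^ 2)⁻¹) ≠ ⊤ := ENNReal.ofReal_ne_top
  have hL : MemLp (f ∘ torusLift) 2 (Measure.pi fun _ : Fin 2 => AddCircle.haarAddCircle) :=
    (hf.smul_measure hc).comp_measurePreserving measurePreserving_torusLift
  have hP := UnitAddTorus.hasSum_sq_mFourierCoeff hL.toLp
  have hI : ∫ t, ‖(hL.toLp : UnitAddTorus (Fin 2) → ℂ) t‖ ^ 2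
      ∂(Measure.pi fun _ : Fin 2 => AddCircle.haarAddCircle)
      = ((2 * Real.pi) ^ 2)⁻¹ * ∫ x in Ω, ‖f x‖ ^ 2 := by
    have hae : (fun t => ‖(hL.toLp : UnitAddTorus (Fin 2) → ℂ) t‖ ^ 2)
        =ᵐ[Measure.pi fun _ : Fin 2 => AddCircle.haarAddCircle]
        fun t => (fun x => ‖f x‖ ^ 2) (torusLift t) := by
      filter_upwards [hL.coeFn_toLp] with t ht
      rw [ht]; rfl
    rw [integral_congr_ae hae]
    exact integral_comp_torusLift (hf.1.norm.pow 2)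
  have hC : ∀ n : Fin 2 → ℤ, UnitAddTorus.mFourierCoeff
      (hL.toLp : UnitAddTorus (Fin 2) → ℂ) n = fourierCoef f (n 0, n 1) := by
    intro n
    rw [← mFourierCoeff_comp_torusLift f hf.1 n]
    refine integral_congr_ae ?_
    filter_upwards [hL.coeFn_toLp] with t ht
    rw [ht]
  simp only [hC] at hP
  rw [← hI, ← (finTwoArrowEquiv ℤ).hasSum_iff]
  exact hP

/-! ### The `L²` pairing on the cell. -/

theorem isCompact_Ω : IsCompact Ω := isCompact_Icc.prod isCompact_Icc

theorem measurableSet_Ω : MeasurableSet Ω := measurableSet_Icc.prod measurableSet_Icc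

theorem memLp_of_continuous {E : Type*} [NormedAddCommGroup E]
    [SecondCountableTopology E] {f : ℝ × ℝ → E} (hf : Continuous f) (p : ENNReal) :
    MemLp f p (volume.restrict Ω) := by
  obtain ⟨C, hC⟩ := isCompact_Ω.exists_bound_of_continuousOn hf.continuousOn
  exact MemLp.of_bound hf.aestronglyMeasurable C
    ((ae_restrict_iff' measurableSet_Ω).2 (Filter.Eventually.of_forall hC))

section InnerProduct

variable {f g h : ℝ × ℝ → ℂ}

theorem memLp_conj (hf : MemLp f 2 (volume.restrict Ω)) :
    MemLp (fun x => (starRingEnd ℂ) (f x)) 2 (volume.restrict Ω) := hf.star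

theorem integrable_ip (hf : MemLp f 2 (volume.restrict Ω)) (hg : MemLp g 2 (volume.restrict Ω)) :
    Integrable (fun x => f x * (starRingEnd ℂ) (g x)) (volume.restrict Ω) :=
  hf.integrable_mul (memLp_conj hg)

theorem ip_add_left (hf : MemLp f 2 (volume.restrict Ω)) (hg : MemLp g 2 (volume.restrict Ω))
    (hh : MemLp h 2 (volume.restrict Ω)) : ip (f + g) h = ip f h + ip g h := by
  simp only [ip, Pi.add_apply, add_mul]
  exact integral_add (integrable_ip hf hh) (integrable_ip hg hh)

theorem ip_sub_left (hf : MemLp f 2 (volume.restrict Ω)) (hg : MemLp g 2 (volume.restrict Ω))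
    (hh : MemLp h 2 (volume.restrict Ω)) : ip (f - g) h = ip f h - ip g h := by
  simp only [ip, Pi.sub_apply, sub_mul]
  exact integral_sub (integrable_ip hf hh) (integrable_ip hg hh)

theorem ip_smul_left (c : ℂ) : ip (c • f) h = c * ip f h := by
  simp only [ip, Pi.smul_apply, smul_eq_mul, mul_assoc]
  exact integral_const_mul _ _

theorem ip_conj_symm : (starRingEnd ℂ) (ip f g) = ip g f := by
  simp only [ip, ← integral_conj, map_mul, Complex.conj_conj, mul_comm]

theorem ip_add_right (hf : MemLp f 2 (volume.restrict Ω)) (hg : MemLp g 2 (volume.restrict Ω))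
    (hh : MemLp h 2 (volume.restrict Ω)) : ip f (g + h) = ip f g + ip f h := by
  rw [← ip_conj_symm, ip_add_left hg hh hf, map_add, ip_conj_symm, ip_conj_symm]

theorem ip_smul_right (c : ℂ) : ip f (c • g) = (starRingEnd ℂ) c * ip f g := by
  rw [← ip_conj_symm, ip_smul_left, map_mul, ip_conj_symm]

theorem ip_sum_right {ι : Type*} (s : Finset ι) (g : ι → ℝ × ℝ → ℂ)
    (hf : MemLp f 2 (volume.restrict Ω)) (hg : ∀ i ∈ s, MemLp (g i) 2 (volume.restrict Ω)) :
    ip f (fun x => ∑ i ∈ s, g i x) = ∑ i ∈ s, ip f (g i) := by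
  simp only [ip, map_sum, Finset.mul_sum]
  exact integral_finsetSum s fun i hi => integrable_ip hf (hg i hi)

theorem l2Norm_nonneg (f : ℝ × ℝ → ℂ) : 0 ≤ l2Norm f := Real.sqrt_nonneg _

theorem l2Norm_sq (f : ℝ × ℝ → ℂ) : l2Norm f ^ 2 = ∫ x in Ω, ‖f x‖ ^ 2 :=
  Real.sq_sqrt (integral_nonneg fun _ => by positivity)

theorem ip_self (f : ℝ × ℝ → ℂ) : ip f f = ((l2Norm f ^ 2 : ℝ) : ℂ) := by
  rw [l2Norm_sq, ← integral_complex_ofReal, ip]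
  congr 1
  ext x
  rw [Complex.mul_conj']
  norm_cast

theorem norm_ip_le (hf : MemLp f 2 (volume.restrict Ω)) (hg : MemLp g 2 (volume.restrict Ω)) :
    ‖ip f g‖ ≤ l2Norm f * l2Norm g := by
  have h1 : ‖ip f g‖ ≤ ∫ x in Ω, ‖f x‖ * ‖g x‖ := by
    refine (norm_integral_le_integral_norm _).trans (le_of_eq ?_)
    simp
  refine h1.trans ?_
  have h2 := integral_mul_le_Lp_mul_Lq_of_nonneg (μ := volume.restrict Ω) (f := fun x => ‖f x‖)
    (g := fun x => ‖g x‖) Real.HolderConjugate.two_two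
    (Filter.Eventually.of_forall fun _ => norm_nonneg _)
    (Filter.Eventually.of_forall fun _ => norm_nonneg _)
    (by simpa using hf.norm) (by simpa using hg.norm)
  simpa [l2Norm, Real.sqrt_eq_rpow] using h2

theorem l2Norm_le_mul {B : ℝ} (hB : 0 ≤ B) (hg : MemLp g 2 (volume.restrict Ω))
    (h : ∀ x ∈ Ω, ‖f x‖ ≤ B * ‖g x‖) : l2Norm f ≤ B * l2Norm g := by
  refine le_of_sq_le_sq ?_ (mul_nonneg hB (l2Norm_nonneg g))
  rw [mul_pow, l2Norm_sq, l2Norm_sq, ← integral_const_mul]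
  refine integral_mono_of_nonneg (Filter.Eventually.of_forall fun _ => by positivity)
    (((memLp_two_iff_integrable_sq_norm hg.1).1 hg).const_mul _)
    ((ae_restrict_iff' measurableSet_Ω).2 (Filter.Eventually.of_forall fun x hx => ?_))
  simp only [← mul_pow]
  exact pow_le_pow_left₀ (norm_nonneg _) (h x hx) 2

end InnerProduct

/-! ### Exponential modes and Fourier coefficients. -/

section Modes

theorem contDiff_expMode (k : ℤ × ℤ) {n : WithTop ℕ∞} : ContDiff ℝ n (expMode k) := by
  unfold expMode
  have h1 : ContDiff ℝ n fun x : ℝ × ℝ => (x.1 : ℂ) := Complex.ofRealCLM.contDiff.comp contDiff_fst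
  have h2 : ContDiff ℝ n fun x : ℝ × ℝ => (x.2 : ℂ) := Complex.ofRealCLM.contDiff.comp contDiff_snd
  exact (contDiff_const.mul ((contDiff_const.mul h1).add (contDiff_const.mul h2))).cexp

theorem continuous_expMode (k : ℤ × ℤ) : Continuous (expMode k) :=
  (contDiff_expMode k (n := 0)).continuous

theorem memLp_expMode (k : ℤ × ℤ) : MemLp (expMode k) 2 (volume.restrict Ω) :=
  memLp_of_continuous (continuous_expMode k) 2

theorem isPeriodic_expMode (k : ℤ × ℤ) : IsPeriodic (expMode k) := by
  intro x
  constructor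
  · refine Complex.exp_eq_exp_iff_exists_int.2 ⟨k.1, ?_⟩
    push_cast
    ring
  · refine Complex.exp_eq_exp_iff_exists_int.2 ⟨k.2, ?_⟩
    push_cast
    ring

theorem conj_expMode (k : ℤ × ℤ) (x : ℝ × ℝ) :
    (starRingEnd ℂ) (expMode k x) =
      Complex.exp (-(Complex.I * ((k.1 : ℂ) * (x.1 : ℂ) + (k.2 : ℂ) * (x.2 : ℂ)))) := by
  rw [expMode, ← Complex.exp_conj]
  simp

theorem norm_expMode (k : ℤ × ℤ) (x : ℝ × ℝ) : ‖expMode k x‖ = 1 := by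
  have h : expMode k x = Complex.exp (((k.1 * x.1 + k.2 * x.2 : ℝ) : ℂ) * Complex.I) := by
    rw [expMode]; congr 1; push_cast; ring
  rw [h, Complex.norm_exp_ofReal_mul_I]

theorem fourierCoef_eq_ip (f : ℝ × ℝ → ℂ) (k : ℤ × ℤ) :
    fourierCoef f k = ((2 * (Real.pi : ℂ)) ^ 2)⁻¹ * ip f (expMode k) := by
  simp only [fourierCoef, ip, conj_expMode]

theorem ip_expMode_right (f : ℝ × ℝ → ℂ) (k : ℤ × ℤ) :
    ip f (expMode k) = (2 * (Real.pi : ℂ)) ^ 2 * fourierCoef f k := by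
  have : (2 * (Real.pi : ℂ)) ^ 2 ≠ 0 := by
    simp [Real.pi_ne_zero]
  rw [fourierCoef_eq_ip, mul_inv_cancel_left₀ this]

theorem integral_exp_int_mul (n : ℤ) :
    ∫ x in Icc (-Real.pi) Real.pi, Complex.exp (Complex.I * ((n : ℂ) * (x : ℂ)))
      = if n = 0 then 2 * (Real.pi : ℂ) else 0 := by
  have hpi := Real.pi_pos
  split_ifs with h
  · subst h
    simp [Measure.real, Real.volume_Icc, ENNReal.toReal_ofReal, hpi.le]
    ring
  · rw [integral_Icc_eq_integral_Ioc, ← intervalIntegral.integral_of_le (by linarith)]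
    have hc : Complex.I * (n : ℂ) ≠ 0 := by simp [h]
    simp only [← mul_assoc]
    rw [integral_exp_mul_complex hc, div_eq_zero_iff]
    left
    rw [sub_eq_zero]
    refine Complex.exp_eq_exp_iff_exists_int.2 ⟨n, ?_⟩
    push_cast
    ring

/-- Fubini splits the integral into two one-dimensional ones, each vanishing unless the frequencies
agree. -/
theorem fourierCoef_expMode (j k : ℤ × ℤ) :
    fourierCoef (expMode j) k = if j = k then 1 else 0 := by
  have h2 : (2 * (Real.pi : ℂ)) ^ 2 ≠ 0 := by simp [Real.pi_ne_zero]
  have h : ∫ x in Ω, expMode j x *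
      Complex.exp (-(Complex.I * ((k.1 : ℂ) * (x.1 : ℂ) + (k.2 : ℂ) * (x.2 : ℂ))))
      = (∫ x in Icc (-Real.pi) Real.pi, Complex.exp (Complex.I * (((j.1 - k.1 : ℤ) : ℂ) * (x : ℂ))))
      * ∫ x in Icc (-Real.pi) Real.pi,
          Complex.exp (Complex.I * (((j.2 - k.2 : ℤ) : ℂ) * (x : ℂ))) := by
    rw [Ω, Measure.volume_eq_prod, ← setIntegral_prod_mul]
    congr 1
    ext x
    rw [expMode, ← Complex.exp_add, ← Complex.exp_add]
    congr 1
    push_cast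
    ring
  rw [fourierCoef, h, integral_exp_int_mul, integral_exp_int_mul]
  simp only [sub_eq_zero, Prod.ext_iff]
  by_cases h1 : j.1 = k.1 <;> by_cases h3 : j.2 = k.2 <;> simp [h1, h3]
  field_simp

end Modes

section FourierCoef

variable {f g : ℝ × ℝ → ℂ}

theorem fourierCoef_add (hf : MemLp f 2 (volume.restrict Ω)) (hg : MemLp g 2 (volume.restrict Ω))
    (k : ℤ × ℤ) : fourierCoef (f + g) k = fourierCoef f k + fourierCoef g k := by
  simp only [fourierCoef_eq_ip, ip_add_left hf hg (memLp_expMode k), mul_add]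

theorem fourierCoef_sub (hf : MemLp f 2 (volume.restrict Ω)) (hg : MemLp g 2 (volume.restrict Ω))
    (k : ℤ × ℤ) : fourierCoef (f - g) k = fourierCoef f k - fourierCoef g k := by
  simp only [fourierCoef_eq_ip, ip_sub_left hf hg (memLp_expMode k), mul_sub]

theorem hasSum_sq_fourierCoef_l2Norm (hf : MemLp f 2 (volume.restrict Ω)) :
    HasSum (fun k => ‖fourierCoef f k‖ ^ 2) (((2 * Real.pi) ^ 2)⁻¹ * l2Norm f ^ 2) := by
  rw [l2Norm_sq]
  exact hasSum_sq_fourierCoef hf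

theorem l2Norm_sq_eq_tsum (hf : MemLp f 2 (volume.restrict Ω)) :
    l2Norm f ^ 2 = (2 * Real.pi) ^ 2 * ∑' k, ‖fourierCoef f k‖ ^ 2 := by
  have := Real.pi_pos
  rw [(hasSum_sq_fourierCoef_l2Norm hf).tsum_eq, mul_inv_cancel_left₀ (by positivity)]

end FourierCoef

/-! ### The derivative in `x₁` and integration by parts. -/

section Derivative

variable {E : Type*} [NormedAddCommGroup E] [NormedSpace ℝ E]

theorem continuous_dx1 {f : ℝ × ℝ → E} (hf : ContDiff ℝ 1 f) : Continuous (dx1 f) :=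
  (hf.continuous_fderiv one_ne_zero).clm_apply continuous_const

theorem isPeriodic_dx1 {f : ℝ × ℝ → E} (hf : IsPeriodic f) : IsPeriodic (dx1 f) := by
  intro x
  have h1 : (fun y : ℝ × ℝ => f (y + (2 * Real.pi, 0))) = f := by
    ext y
    rw [← (hf y).1]
    congr 1
    simp [Prod.ext_iff]
  have h2 : (fun y : ℝ × ℝ => f (y + (0, 2 * Real.pi))) = f := by
    ext y
    rw [← (hf y).2]
    congr 1
    simp [Prod.ext_iff]
  constructor
  · have := fderiv_comp_add_right (𝕜 := ℝ) (f := f) (x := x) (2 * Real.pi, 0)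
    rw [h1] at this
    simp only [dx1, this]
    congr 2
    simp [Prod.ext_iff]
  · have := fderiv_comp_add_right (𝕜 := ℝ) (f := f) (x := x) (0, 2 * Real.pi)
    rw [h2] at this
    simp only [dx1, this]
    congr 2
    simp [Prod.ext_iff]

/-- The derivative `∂_{x₁}` of a periodic function has mean zero. -/
theorem integral_dx1_eq_zero [CompleteSpace E] {f : ℝ × ℝ → E} (hf : ContDiff ℝ 1 f)
    (hp : IsPeriodic f) : ∫ x in Ω, dx1 f x = 0 := by
  have hpi := Real.pi_pos
  have hΩ : Icc ((-Real.pi, -Real.pi) : ℝ × ℝ) (Real.pi, Real.pi) = Ω := (Icc_prod_Icc _ _ _ _).symm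
  -- Divergence theorem for the field `(f, 0)`: only the faces `x₁ = ±π` carry flux, and periodicity
  -- cancels them.
  have h := integral_divergence_prod_Icc_of_hasFDerivAt_of_le f (fun _ => (0 : E)) (fderiv ℝ f)
    (fun _ => 0) (-Real.pi, -Real.pi) (Real.pi, Real.pi)
    (Prod.mk_le_mk.2 ⟨by linarith, by linarith⟩) hf.continuous.continuousOn continuousOn_const
    (fun x _ => (hf.differentiable one_ne_zero x).hasFDerivAt)
    (fun x _ => hasFDerivAt_const _ _)
    (by
      simp only [zero_apply, add_zero]
      rw [hΩ]
      exact (continuous_dx1 hf).continuousOn.integrableOn_compact isCompact_Ω)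
  simp only [zero_apply, add_zero, hΩ, intervalIntegral.integral_zero, sub_zero, zero_add] at h
  rw [show (fun x => dx1 f x) = fun x => fderiv ℝ f x (1, 0) from rfl, h, sub_eq_zero]
  congr 1
  ext y
  rw [← (hp (-Real.pi, y)).1]
  congr 2
  ring

theorem dx1_mul {f g : ℝ × ℝ → ℂ} (hf : Differentiable ℝ f) (hg : Differentiable ℝ g)
    (x : ℝ × ℝ) : dx1 (fun x => f x * g x) x = dx1 f x * g x + f x * dx1 g x := by
  simp only [dx1]
  rw [fderiv_fun_mul (hf x) (hg x)]
  simp only [add_apply, smul_apply, smul_eq_mul]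
  ring

theorem dx1_ofReal {u : ℝ × ℝ → ℝ} (hu : Differentiable ℝ u) (x : ℝ × ℝ) :
    dx1 (fun x => (u x : ℂ)) x = ((dx1 u x : ℝ) : ℂ) := by
  have := (Complex.ofRealCLM.hasFDerivAt (x := u x)).comp x (hu x).hasFDerivAt
  simp only [dx1]
  erw [this.fderiv]
  simp

theorem dx1_conj {f : ℝ × ℝ → ℂ} (hf : Differentiable ℝ f) (x : ℝ × ℝ) :
    dx1 (fun x => (starRingEnd ℂ) (f x)) x = (starRingEnd ℂ) (dx1 f x) := by
  have := ((Complex.conjCLE : ℂ →L[ℝ] ℂ).hasFDerivAt (x := f x)).comp x (hf x).hasFDerivAt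
  simp only [dx1]
  erw [this.fderiv]
  simp

theorem contDiff_ofReal_comp {u : ℝ × ℝ → ℝ} {n : WithTop ℕ∞} (hu : ContDiff ℝ n u) :
    ContDiff ℝ n fun x => (u x : ℂ) := Complex.ofRealCLM.contDiff.comp hu

theorem dx1_ofReal_mul {u : ℝ × ℝ → ℝ} {v : ℝ × ℝ → ℂ} (hu : ContDiff ℝ 1 u)
    (hv : ContDiff ℝ 1 v) :
    dx1 (fun x => (u x : ℂ) * v x) =
      (fun x => ((dx1 u x : ℝ) : ℂ) * v x) + fun x => (u x : ℂ) * dx1 v x := by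
  ext x
  rw [dx1_mul ((contDiff_ofReal_comp hu).differentiable one_ne_zero)
    (hv.differentiable one_ne_zero), dx1_ofReal (hu.differentiable one_ne_zero)]
  rfl

/-- Integration by parts for `(v, ∂_{x₁}(u v))`. -/
theorem re_ip_dx1_mul_self {u : ℝ × ℝ → ℝ} {v : ℝ × ℝ → ℂ} (hu : ContDiff ℝ 1 u)
    (hup : IsPeriodic u) (hv : ContDiff ℝ 1 v) (hvp : IsPeriodic v) :
    (ip v (dx1 fun x => (u x : ℂ) * v x)).re = 1 / 2 * ∫ x in Ω, dx1 u x * ‖v x‖ ^ 2 := by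
  have hu' := contDiff_ofReal_comp hu
  have hv' : ContDiff ℝ 1 fun x => (starRingEnd ℂ) (v x) := Complex.conjCLE.contDiff.comp hv
  have hc1 := continuous_dx1 hu
  have hc2 := continuous_dx1 hv
  have hcu := hu.continuous
  have hcv := hv.continuous
  have hint : ∀ {F : ℝ × ℝ → ℂ}, Continuous F → IntegrableOn F Ω := fun hF =>
    hF.continuousOn.integrableOn_compact isCompact_Ω
  have hstar : Continuous (starRingEnd ℂ) := Complex.continuous_conj
  have h0 := integral_dx1_eq_zero ((hu'.mul hv).mul hv') (fun x => by
    simp [(hup x).1, (hup x).2, (hvp x).1, (hvp x).2])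
  set A : ℂ := ∫ x in Ω, (u x : ℂ) * v x * (starRingEnd ℂ) (dx1 v x) with hA
  set B : ℂ := ∫ x in Ω, ((dx1 u x : ℝ) : ℂ) * (v x * (starRingEnd ℂ) (v x)) with hB
  have hA' : (starRingEnd ℂ) A = ∫ x in Ω, (u x : ℂ) * dx1 v x * (starRingEnd ℂ) (v x) := by
    rw [hA, ← integral_conj]
    congr 1
    ext x
    simp only [map_mul, Complex.conj_conj, Complex.conj_ofReal]
    ring
  have hBr : B = ((∫ x in Ω, dx1 u x * ‖v x‖ ^ 2 : ℝ) : ℂ) := by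
    rw [hB, ← integral_complex_ofReal]
    congr 1
    ext x
    rw [Complex.mul_conj']
    norm_cast
  -- This is the mean of `∂₁(u v conj v)`, which is zero. Hence `Re A = -B / 2`, and the wanted real
  -- part `Re (B + A)` is `B / 2`.
  have hsum : B + (starRingEnd ℂ) A + A = 0 := by
    rw [hA', hB, hA, ← integral_add (hint (by fun_prop)) (hint (by fun_prop)),
      ← integral_add ((hint (by fun_prop))) (hint (by fun_prop)), ← h0]
    congr 1
    ext x
    rw [dx1_mul ((hu'.mul hv).differentiable one_ne_zero) (hv'.differentiable one_ne_zero),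
      dx1_mul (hu'.differentiable one_ne_zero) (hv.differentiable one_ne_zero),
      dx1_ofReal (hu.differentiable one_ne_zero), dx1_conj (hv.differentiable one_ne_zero)]
    ring
  have hip : ip v (dx1 fun x => (u x : ℂ) * v x) = B + A := by
    rw [dx1_ofReal_mul hu hv, hA, hB, ← integral_add (hint (by fun_prop)) (hint (by fun_prop)), ip]
    congr 1
    ext x
    simp only [Pi.add_apply, map_add, map_mul, Complex.conj_ofReal]
    ring
  have hre := congrArg Complex.re hsum
  have hB' : B.re = ∫ x in Ω, dx1 u x * ‖v x‖ ^ 2 := by rw [hBr, Complex.ofReal_re]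
  simp only [Complex.add_re, Complex.conj_re, Complex.zero_re] at hre
  rw [hip, Complex.add_re, ← hB']
  linarith

theorem dx1_expMode (k : ℤ × ℤ) (x : ℝ × ℝ) :
    dx1 (expMode k) x = Complex.I * (k.1 : ℂ) * expMode k x := by
  have h1 : HasFDerivAt (fun x : ℝ × ℝ => (x.1 : ℂ))
      (Complex.ofRealCLM.comp (ContinuousLinearMap.fst ℝ ℝ ℝ)) x :=
    (Complex.ofRealCLM.comp (ContinuousLinearMap.fst ℝ ℝ ℝ)).hasFDerivAt
  have h2 : HasFDerivAt (fun x : ℝ × ℝ => (x.2 : ℂ))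
      (Complex.ofRealCLM.comp (ContinuousLinearMap.snd ℝ ℝ ℝ)) x :=
    (Complex.ofRealCLM.comp (ContinuousLinearMap.snd ℝ ℝ ℝ)).hasFDerivAt
  have h := (((h1.const_mul (k.1 : ℂ)).add (h2.const_mul (k.2 : ℂ))).const_mul Complex.I).cexp
  rw [dx1, show expMode k = fun x : ℝ × ℝ => Complex.exp
    (Complex.I * ((k.1 : ℂ) * (x.1 : ℂ) + (k.2 : ℂ) * (x.2 : ℂ))) from rfl]
  erw [h.fderiv]
  simp
  ring

end Derivative

/-! ### Trigonometric polynomials and the action of the operators on their coefficients. -/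

section TrigonometricPolynomials

/-- The trigonometric polynomial with coefficients `c` and frequencies in `s`. -/
noncomputable def trig (s : Finset (ℤ × ℤ)) (c : ℤ × ℤ → ℂ) (x : ℝ × ℝ) : ℂ :=
  ∑ k ∈ s, c k * expMode k x

/-- The square `max (|k₁|, |k₂|) ≤ N` of frequencies. -/
noncomputable def box (N : ℕ) : Finset (ℤ × ℤ) := Finset.Icc (-(N : ℤ)) N ×ˢ Finset.Icc (-(N : ℤ)) N

theorem mem_box {N : ℕ} {k : ℤ × ℤ} : k ∈ box N ↔ max |k.1| |k.2| ≤ (N : ℤ) := by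
  simp [box, abs_le]

theorem trig_eq_sum (s : Finset (ℤ × ℤ)) (c : ℤ × ℤ → ℂ) :
    trig s c = ∑ k ∈ s, c k • expMode k := by
  ext x
  simp [trig]

theorem mem_trigSpace {N : ℕ} {v : ℝ × ℝ → ℂ} :
    v ∈ trigSpace N ↔ ∃ c, v = trig (box N) c := by
  have h : {k : ℤ × ℤ | max |k.1| |k.2| ≤ (N : ℤ)} = (box N : Set (ℤ × ℤ)) := by
    ext k
    exact mem_box.symm
  rw [trigSpace, h]
  constructor
  · intro hv
    obtain ⟨c, rfl⟩ := Submodule.mem_span_image_finset_iff_exists_fun ℂ |>.1 hv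
    obtain ⟨c', hc'⟩ : ∃ c' : ℤ × ℤ → ℂ, ∀ k : box N, c' k = c k :=
      ⟨Function.extend Subtype.val c 0, fun k => Subtype.val_injective.extend_apply c 0 k⟩
    refine ⟨c', ?_⟩
    rw [trig_eq_sum, ← Finset.sum_coe_sort (box N) fun k => c' k • expMode k]
    exact Finset.sum_congr rfl fun k _ => by rw [hc' k]
  · rintro ⟨c, rfl⟩
    rw [trig_eq_sum]
    exact Submodule.sum_mem _ fun k hk =>
      Submodule.smul_mem _ _ (Submodule.subset_span (mem_image_of_mem _ hk))

variable (s : Finset (ℤ × ℤ)) (c d : ℤ × ℤ → ℂ)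

theorem contDiff_trig {n : WithTop ℕ∞} : ContDiff ℝ n (trig s c) := by
  unfold trig
  exact ContDiff.sum fun k _ => contDiff_const.mul (contDiff_expMode k)

theorem continuous_trig : Continuous (trig s c) := (contDiff_trig s c (n := 0)).continuous

theorem memLp_trig : MemLp (trig s c) 2 (volume.restrict Ω) :=
  memLp_of_continuous (continuous_trig s c) 2

theorem isPeriodic_trig : IsPeriodic (trig s c) := fun x => by
  simp only [trig, (isPeriodic_expMode _ x).1, (isPeriodic_expMode _ x).2, and_self]

theorem ip_trig_right {f : ℝ × ℝ → ℂ} (hf : MemLp f 2 (volume.restrict Ω)) :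
    ip f (trig s c) =
      (2 * (Real.pi : ℂ)) ^ 2 * ∑ k ∈ s, fourierCoef f k * (starRingEnd ℂ) (c k) := by
  have h : trig s c = fun x => ∑ k ∈ s, (c k • expMode k) x := rfl
  rw [h, ip_sum_right s _ hf fun k _ => (memLp_expMode k).const_smul (c k), Finset.mul_sum]
  refine Finset.sum_congr rfl fun k _ => ?_
  rw [ip_smul_right, ip_expMode_right]
  ring

theorem fourierCoef_trig (k : ℤ × ℤ) :
    fourierCoef (trig s c) k = if k ∈ s then c k else 0 := by
  have h2 : (2 * (Real.pi : ℂ)) ^ 2 ≠ 0 := by simp [Real.pi_ne_zero]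
  rw [fourierCoef_eq_ip, ← ip_conj_symm, ip_trig_right s c (memLp_expMode k)]
  simp only [fourierCoef_expMode, ite_mul, one_mul, zero_mul, Finset.sum_ite_eq]
  split_ifs
  · simp only [map_mul, map_pow, Complex.conj_conj, Complex.conj_ofReal, Complex.conj_ofNat]
    rw [inv_mul_cancel_left₀ h2]
  · simp

theorem ip_trig_trig :
    ip (trig s c) (trig s d) = (2 * (Real.pi : ℂ)) ^ 2 * ∑ k ∈ s, c k * (starRingEnd ℂ) (d k) := by
  rw [ip_trig_right s d (memLp_trig s c)]
  congr 1
  refine Finset.sum_congr rfl fun k hk => ?_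
  rw [fourierCoef_trig, if_pos hk]

theorem l2Norm_trig_sq : l2Norm (trig s c) ^ 2 = (2 * Real.pi) ^ 2 * ∑ k ∈ s, ‖c k‖ ^ 2 := by
  have h := ip_self (trig s c)
  rw [ip_trig_trig] at h
  simp only [Complex.mul_conj'] at h
  exact_mod_cast h.symm

theorem dx1_trig : dx1 (trig s c) = trig s fun k => Complex.I * (k.1 : ℂ) * c k := by
  ext x
  have htrig : trig s c = ∑ k ∈ s, fun x => c k * expMode k x := by
    ext x
    simp [trig]
  rw [dx1, htrig, trig]
  have hd : ∀ k ∈ s, DifferentiableAt ℝ (expMode k) x := fun k _ =>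
    (contDiff_expMode k (n := 1)).differentiable one_ne_zero x
  rw [fderiv_sum fun k hk => (hd k hk).const_mul (c k), sum_apply]
  refine Finset.sum_congr rfl fun k hk => ?_
  rw [fderiv_const_mul (hd k hk), smul_apply, smul_eq_mul]
  have := dx1_expMode k x
  rw [dx1] at this
  rw [this]
  ring

theorem fracLap_trig (α : ℝ) :
    fracLap α (trig s c) = trig s fun k => ((freqNorm k ^ α : ℝ) : ℂ) * c k := by
  ext x
  rw [fracLap, tsum_eq_sum (s := s)]
  · refine Finset.sum_congr rfl fun k hk => ?_
    rw [fourierCoef_trig, if_pos hk]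
  · intro k hk
    rw [fourierCoef_trig, if_neg hk]
    simp

theorem trig_sub : trig s c - trig s d = trig s (c - d) := by
  ext x
  simp [trig, sub_mul, Finset.sum_sub_distrib]

end TrigonometricPolynomials

/-! ### Uniform stability of the Galerkin part. -/

theorem IsPeriodic.exists_mem_Ω {E : Type*} {f : ℝ × ℝ → E} (hf : IsPeriodic f) (x : ℝ × ℝ) :
    ∃ y ∈ Ω, f x = f y := by
  have hpi := Real.two_pi_pos
  obtain ⟨a, ha, hxa⟩ := Function.Periodic.exists_mem_Ioc (f := fun t => f (t, x.2))
    (c := 2 * Real.pi) (fun t => (hf (t, x.2)).1) hpi x.1 (-Real.pi)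
  obtain ⟨b, hb, hxb⟩ := Function.Periodic.exists_mem_Ioc (f := fun t => f (a, t))
    (c := 2 * Real.pi) (fun t => (hf (a, t)).2) hpi x.2 (-Real.pi)
  rw [show -Real.pi + 2 * Real.pi = Real.pi by ring] at ha hb
  exact ⟨(a, b), ⟨Ioc_subset_Icc_self ha, Ioc_subset_Icc_self hb⟩, hxa.trans hxb⟩

theorem IsPeriodic.exists_bound {f : ℝ × ℝ → ℝ} (hf : IsPeriodic f) (hc : Continuous f) :
    ∃ B, 0 ≤ B ∧ ∀ x, |f x| ≤ B := by
  obtain ⟨B, hB⟩ := isCompact_Ω.exists_bound_of_continuousOn hc.continuousOn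
  refine ⟨max B 0, le_max_right _ _, fun x => ?_⟩
  obtain ⟨y, hy, hxy⟩ := hf.exists_mem_Ω x
  rw [hxy]
  exact (hB y hy).trans (le_max_left _ _)

/-- If the bound failed then `s ≤ x`, so the right side would be at most `(A + B) * s * x`, while `x
^ 2` would exceed `(A + B + 1) * s * x`. This absorbs the cross terms in the two energy estimates.
-/
theorem le_of_sq_le_mul {x s A B : ℝ} (hx : 0 ≤ x) (hs : 0 ≤ s) (hA : 0 ≤ A) (hB : 0 ≤ B)
    (h : x ^ 2 ≤ A * s ^ 2 + B * s * x) : x ≤ (A + B + 1) * s := by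
  by_contra! hc
  have hsx : s ≤ x := by nlinarith [mul_nonneg hA hs, mul_nonneg hB hs]
  have hx0 : 0 < x := lt_of_le_of_lt (by positivity) hc
  nlinarith [mul_lt_mul_of_pos_right hc hx0, mul_le_mul_of_nonneg_left hsx (mul_nonneg hA hs),
    mul_nonneg hs hx]

section Pairing

variable {α K : ℝ} {u : ℝ × ℝ → ℝ} {s : Finset (ℤ × ℤ)} {c d : ℤ × ℤ → ℂ} {f g : ℝ × ℝ → ℂ}

theorem memLp_dx1_mul_trig (hu : ContDiff ℝ 1 u) :
    MemLp (dx1 fun x => (u x : ℂ) * trig s c x) 2 (volume.restrict Ω) :=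
  memLp_of_continuous (continuous_dx1 ((contDiff_ofReal_comp hu).mul (contDiff_trig s c))) 2

theorem fracLap_dx1_trig : fracLap α (dx1 (trig s c)) =
    trig s fun k => ((freqNorm k ^ α : ℝ) : ℂ) * (Complex.I * (k.1 : ℂ) * c k) := by
  rw [dx1_trig, fracLap_trig]

theorem pairing_sub_left (hu : ContDiff ℝ 1 u) (hf : MemLp f 2 (volume.restrict Ω))
    (hg : MemLp g 2 (volume.restrict Ω)) :
    pairing α K u (f - g) (trig s c) = pairing α K u f (trig s c) - pairing α K u g (trig s c) := by
  simp only [pairing, fracLap_dx1_trig]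
  rw [ip_sub_left hf hg (memLp_trig _ _), ip_sub_left hf hg (memLp_dx1_mul_trig hu),
    ip_sub_left hf hg (memLp_trig _ _)]
  ring

theorem ip_trig_eq_zero (hf : MemLp f 2 (volume.restrict Ω)) (h0 : ∀ k ∈ s, fourierCoef f k = 0) :
    ip f (trig s c) = 0 := by
  rw [ip_trig_right s c hf, Finset.sum_eq_zero fun k hk => by rw [h0 k hk, zero_mul], mul_zero]

/-- Constant-coefficient operators keep the frequencies of the test function in `s`, so
orthogonality removes them. Multiplication by `u` moves frequencies and remains. -/
theorem pairing_of_orthogonal (hf : MemLp f 2 (volume.restrict Ω))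
    (h0 : ∀ k ∈ s, fourierCoef f k = 0) :
    pairing α K u f (trig s c) = -ip f (dx1 fun x => (u x : ℂ) * trig s c x) := by
  rw [pairing, fracLap_dx1_trig, ip_trig_eq_zero hf h0, ip_trig_eq_zero hf h0]
  ring

/-- As `f` is only square-integrable, the derivative stays on the other factor. The resulting
`‖∂₁v‖` is what the Hilbert transform test must control. -/
theorem norm_ip_dx1_mul_trig_le {M U : ℝ} (hM0 : 0 ≤ M) (hU0 : 0 ≤ U)
    (hM : ∀ x, |dx1 u x| ≤ M) (hU : ∀ x, |u x| ≤ U) (hu : ContDiff ℝ 1 u)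
    (hf : MemLp f 2 (volume.restrict Ω)) :
    ‖ip f (dx1 fun x => (u x : ℂ) * trig s c x)‖ ≤
      l2Norm f * (M * l2Norm (trig s c) + U * l2Norm (dx1 (trig s c))) := by
  have hv : ContDiff ℝ 1 (trig s c) := contDiff_trig s c
  have hcv := hv.continuous
  have hcu := hu.continuous
  have hcdv := continuous_dx1 hv
  have hcdu := continuous_dx1 hu
  have h1 : MemLp (fun x => ((dx1 u x : ℝ) : ℂ) * trig s c x) 2 (volume.restrict Ω) :=
    memLp_of_continuous (by fun_prop) 2
  have h2 : MemLp (fun x => (u x : ℂ) * dx1 (trig s c) x) 2 (volume.restrict Ω) :=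
    memLp_of_continuous (by fun_prop) 2
  have hn := l2Norm_nonneg f
  rw [dx1_ofReal_mul hu hv, ip_add_right hf h1 h2, mul_add]
  refine (norm_add_le _ _).trans (add_le_add ?_ ?_)
  · refine (norm_ip_le hf h1).trans (mul_le_mul_of_nonneg_left ?_ hn)
    refine l2Norm_le_mul hM0 (memLp_trig s c) fun x _ => ?_
    rw [norm_mul, Complex.norm_real]
    exact mul_le_mul_of_nonneg_right (hM x) (norm_nonneg _)
  · refine (norm_ip_le hf h2).trans (mul_le_mul_of_nonneg_left ?_ hn)
    refine l2Norm_le_mul hU0 (memLp_of_continuous hcdv 2) fun x _ => ?_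
    rw [norm_mul, Complex.norm_real]
    exact mul_le_mul_of_nonneg_right (hU x) (norm_nonneg _)

/-- The dispersive term does not contribute to the energy. -/
theorem re_ip_fracLap_dx1_self : (ip (trig s c) (fracLap α (dx1 (trig s c)))).re = 0 := by
  -- The symbol `i k₁ |k|^α` is purely imaginary, so each summand is a real number times `i`.
  have h : ∀ k ∈ s, c k * (starRingEnd ℂ)
      (((freqNorm k ^ α : ℝ) : ℂ) * (Complex.I * (k.1 : ℂ) * c k)) =
      ((-(freqNorm k ^ α * k.1 * ‖c k‖ ^ 2) : ℝ) : ℂ) * Complex.I := by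
    intro k _
    simp only [map_mul, Complex.conj_ofReal, Complex.conj_I, map_intCast]
    push_cast
    rw [← Complex.mul_conj']
    ring
  rw [fracLap_dx1_trig, ip_trig_trig, Finset.sum_congr rfl h, ← Finset.sum_mul]
  have h2 : (2 * (Real.pi : ℂ)) ^ 2 = (((2 * Real.pi) ^ 2 : ℝ) : ℂ) := by push_cast; rfl
  rw [h2, Complex.re_ofReal_mul, ← Complex.ofReal_sum, Complex.re_ofReal_mul]
  simp

/-- Coercivity of the bilinear form in `L²`. -/
theorem le_re_pairing_self {M : ℝ} (hM : ∀ x, |dx1 u x| ≤ M) (hu : ContDiff ℝ 1 u)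
    (hup : IsPeriodic u) :
    (K - 1 / 2 * M) * l2Norm (trig s c) ^ 2 ≤ (pairing α K u (trig s c) (trig s c)).re := by
  have hv : ContDiff ℝ 1 (trig s c) := contDiff_trig s c
  have hcv := hv.continuous
  have hcdu := continuous_dx1 hu
  have h1 : ∫ x in Ω, dx1 u x * ‖trig s c x‖ ^ 2 ≤ M * l2Norm (trig s c) ^ 2 := by
    rw [l2Norm_sq, ← integral_const_mul]
    refine integral_mono ?_ ?_ fun x => ?_
    · exact (Continuous.continuousOn (by fun_prop)).integrableOn_compact isCompact_Ω
    · exact (Continuous.continuousOn (by fun_prop)).integrableOn_compact isCompact_Ω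
    · exact mul_le_mul_of_nonneg_right ((le_abs_self _).trans (hM x)) (by positivity)
  rw [pairing, Complex.add_re, Complex.sub_re, re_ip_fracLap_dx1_self,
    re_ip_dx1_mul_self hu hup hv (isPeriodic_trig s c), Complex.re_ofReal_mul, ip_self,
    Complex.ofReal_re]
  linarith

/-- Testing with the Hilbert transform in `x₁`: the dispersive term controls `∂_{x₁}`. -/
theorem l2Norm_dx1_sq_le (hα : 1 ≤ α) :
    l2Norm (dx1 (trig s c)) ^ 2 ≤
      (ip (trig s c) (fracLap α (dx1 (trig s fun k =>
        -Complex.I * ((SignType.sign k.1 : ℤ) : ℂ) * c k)))).re := by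
  -- The symbol `-i sign k₁` turns `i k₁` into `|k₁|`, making the dispersive form nonnegative.
  have h : ∀ k ∈ s, c k * (starRingEnd ℂ) (((freqNorm k ^ α : ℝ) : ℂ) * (Complex.I * (k.1 : ℂ) *
      (-Complex.I * ((SignType.sign k.1 : ℤ) : ℂ) * c k))) =
      ((freqNorm k ^ α * |(k.1 : ℝ)| * ‖c k‖ ^ 2 : ℝ) : ℂ) := by
    intro k _
    have hσ := self_mul_sign k.1
    generalize (SignType.sign k.1 : ℤ) = σ at hσ ⊢
    have hs : ((|(k.1 : ℝ)| : ℝ) : ℂ) = (k.1 : ℂ) * (σ : ℂ) := by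
      rw [← Int.cast_abs, ← hσ]
      push_cast
      rfl
    simp only [map_mul, map_neg, Complex.conj_ofReal, Complex.conj_I, map_intCast]
    push_cast
    rw [hs, ← Complex.mul_conj']
    linear_combination (-(freqNorm k ^ α : ℝ) * (k.1 : ℂ) * (σ : ℂ) *
      (c k * (starRingEnd ℂ) (c k))) * Complex.I_sq
  rw [fracLap_dx1_trig, ip_trig_trig, Finset.sum_congr rfl h, dx1_trig, l2Norm_trig_sq]
  have h2 : (2 * (Real.pi : ℂ)) ^ 2 = (((2 * Real.pi) ^ 2 : ℝ) : ℂ) := by push_cast; rfl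
  rw [h2, Complex.re_ofReal_mul, ← Complex.ofReal_sum, Complex.ofReal_re]
  refine mul_le_mul_of_nonneg_left (Finset.sum_le_sum fun k _ => ?_) (by positivity)
  -- Here `α ≥ 1` enters: a nonzero integer `k₁` has `1 ≤ |k₁| ≤ |k| ≤ |k|^α`.
  have hk : |(k.1 : ℝ)| ^ 2 ≤ freqNorm k ^ α * |(k.1 : ℝ)| := by
    rcases eq_or_ne k.1 0 with h0 | h0
    · simp [h0]
    · have h1 : 1 ≤ |(k.1 : ℝ)| := by
        rw [← Int.cast_abs]
        exact_mod_cast Int.one_le_abs h0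
      have h3 : |(k.1 : ℝ)| ≤ freqNorm k := Real.abs_le_sqrt (by nlinarith [sq_nonneg (k.2 : ℝ)])
      have h4 : |(k.1 : ℝ)| ≤ freqNorm k ^ α :=
        h3.trans (Real.self_le_rpow_of_one_le (h1.trans h3) hα)
      rw [sq]
      exact mul_le_mul_of_nonneg_right h4 (abs_nonneg _)
  rw [norm_mul, norm_mul, Complex.norm_I, one_mul, mul_pow, Complex.norm_intCast]
  exact mul_le_mul_of_nonneg_right hk (by positivity)

/-- The Galerkin part of the error is controlled, uniformly in the frequency set, by the
`L²` norm of the truncation error. -/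
theorem exists_stability_const (hα : 1 ≤ α) (hu : ContDiff ℝ 1 u) (hup : IsPeriodic u)
    (hK : (1 / 2 : ℝ) * (⨆ x : ℝ × ℝ, |dx1 u x|) < K) :
    ∃ C : ℝ, 0 ≤ C ∧ ∀ (s : Finset (ℤ × ℤ)) (c : ℤ × ℤ → ℂ) (f : ℝ × ℝ → ℂ),
      MemLp f 2 (volume.restrict Ω) → (∀ k ∈ s, fourierCoef f k = 0) →
      (∀ d, pairing α K u (trig s c - f) (trig s d) = 0) →
      l2Norm (trig s c) ≤ C * l2Norm f := by
  obtain ⟨B, -, hB⟩ := (isPeriodic_dx1 hup).exists_bound (continuous_dx1 hu)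
  obtain ⟨U, hU0, hU⟩ := hup.exists_bound hu.continuous
  set M := ⨆ x : ℝ × ℝ, |dx1 u x| with hMdef
  -- A real supremum bounds its family only if the family is bounded; periodicity and continuity
  -- supply that.
  have hM : ∀ x, |dx1 u x| ≤ M := fun x => le_ciSup ⟨B, forall_mem_range.2 hB⟩ x
  have hM0 : 0 ≤ M := (abs_nonneg _).trans (hM 0)
  have hK0 : 0 ≤ K := by linarith
  have hδ : 0 < K - 1 / 2 * M := by linarith
  set δ := K - 1 / 2 * M with hδdef
  set D := K + M + U + 1 with hD
  have hD0 : 0 ≤ D := by positivity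
  refine ⟨U * D / δ + (M + U * D) / δ + 1, by positivity, fun s c f hf h0 hp => ?_⟩
  have hpair : ∀ d, pairing α K u (trig s c) (trig s d) =
      -ip f (dx1 fun x => (u x : ℂ) * trig s d x) := fun d => by
    have := hp d
    rw [pairing_sub_left hu (memLp_trig s c) hf, pairing_of_orthogonal hf h0] at this
    exact sub_eq_zero.1 this
  set a := l2Norm (trig s c) with ha
  set b := l2Norm (dx1 (trig s c)) with hb
  set h := l2Norm f with hh
  have ha0 : 0 ≤ a := l2Norm_nonneg _
  have hb0 : 0 ≤ b := l2Norm_nonneg _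
  have hh0 : 0 ≤ h := l2Norm_nonneg _
  -- First test, `v = θ`: coercivity against the residual of `f`.
  have e1 : δ * a ^ 2 ≤ h * (M * a + U * b) := by
    refine (le_re_pairing_self (α := α) hM hu hup).trans ((Complex.re_le_norm _).trans ?_)
    rw [hpair, norm_neg]
    exact norm_ip_dx1_mul_trig_le hM0 hU0 hM hU hu hf
  -- Second test, with the Hilbert transform `d` of `c`. Its multiplier has modulus at most one, so
  -- neither norm of `trig s d` exceeds that of `trig s c`.
  have e2 : b ^ 2 ≤ (K + M) * a ^ 2 + U * a * b + h * (M * a + U * b) := by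
    set d : ℤ × ℤ → ℂ := fun k => -Complex.I * ((SignType.sign k.1 : ℤ) : ℂ) * c k with hd
    have hsign : ∀ k : ℤ × ℤ, ‖((SignType.sign k.1 : ℤ) : ℂ)‖ ≤ 1 := by
      intro k
      rcases lt_trichotomy k.1 0 with hk | hk | hk <;> simp [hk]
    have hda : l2Norm (trig s d) ≤ a := by
      refine le_of_sq_le_sq ?_ ha0
      rw [ha, l2Norm_trig_sq, l2Norm_trig_sq]
      refine mul_le_mul_of_nonneg_left (Finset.sum_le_sum fun k _ => ?_) (by positivity)
      refine pow_le_pow_left₀ (norm_nonneg _) ?_ 2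
      rw [hd, norm_mul, norm_mul, norm_neg, Complex.norm_I, one_mul]
      exact mul_le_of_le_one_left (norm_nonneg (c k)) (hsign k)
    have hdb : l2Norm (dx1 (trig s d)) ≤ b := by
      refine le_of_sq_le_sq ?_ hb0
      rw [hb, dx1_trig, dx1_trig, l2Norm_trig_sq, l2Norm_trig_sq]
      refine mul_le_mul_of_nonneg_left (Finset.sum_le_sum fun k _ => ?_) (by positivity)
      refine pow_le_pow_left₀ (norm_nonneg _) ?_ 2
      rw [hd, norm_mul, norm_mul (Complex.I * (k.1 : ℂ)) (c k)]
      refine mul_le_mul_of_nonneg_left ?_ (norm_nonneg _)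
      rw [norm_mul, norm_mul, norm_neg, Complex.norm_I, one_mul]
      exact mul_le_of_le_one_left (norm_nonneg (c k)) (hsign k)
    have key := l2Norm_dx1_sq_le (s := s) (c := c) hα
    have hsplit : ip (trig s c) (fracLap α (dx1 (trig s d))) =
        pairing α K u (trig s c) (trig s d) - (K : ℂ) * ip (trig s c) (trig s d) +
          ip (trig s c) (dx1 fun x => (u x : ℂ) * trig s d x) := by
      rw [pairing]
      ring
    have hmono : M * l2Norm (trig s d) + U * l2Norm (dx1 (trig s d)) ≤ M * a + U * b := by gcongr
    have t1 : ‖pairing α K u (trig s c) (trig s d)‖ ≤ h * (M * a + U * b) := by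
      rw [hpair, norm_neg]
      exact (norm_ip_dx1_mul_trig_le hM0 hU0 hM hU hu hf).trans
        (mul_le_mul_of_nonneg_left hmono hh0)
    have t2 : ‖(K : ℂ) * ip (trig s c) (trig s d)‖ ≤ K * (a * a) := by
      rw [norm_mul, Complex.norm_of_nonneg hK0]
      refine mul_le_mul_of_nonneg_left ?_ hK0
      exact (norm_ip_le (memLp_trig _ _) (memLp_trig _ _)).trans
        (mul_le_mul_of_nonneg_left hda ha0)
    have t3 : ‖ip (trig s c) (dx1 fun x => (u x : ℂ) * trig s d x)‖ ≤ a * (M * a + U * b) :=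
      (norm_ip_dx1_mul_trig_le hM0 hU0 hM hU hu (memLp_trig s c)).trans
        (mul_le_mul_of_nonneg_left hmono ha0)
    have t4 : b ^ 2 ≤ h * (M * a + U * b) + K * (a * a) + a * (M * a + U * b) := by
      refine key.trans ((Complex.re_le_norm _).trans ?_)
      rw [hsplit]
      exact (norm_add_le _ _).trans (add_le_add ((norm_sub_le _ _).trans (add_le_add t1 t2)) t3)
    linarith
  -- `le_of_sq_le_mul` with `s = a + h`, `A = K + M`, `B = U`, which explains the value of `D`.
  have e3 : b ≤ D * (a + h) := by
    refine le_of_sq_le_mul hb0 (by positivity) (by positivity) hU0 ?_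
    refine e2.trans ?_
    have : 0 ≤ (K + M) * (a * h) + K * (a * h) + (K + M) * h ^ 2 := by positivity
    linarith
  refine le_of_sq_le_mul ha0 hh0 (by positivity) (by positivity) ?_
  -- Inserting `e3` into `e1` eliminates `b`. Dividing by `δ` and absorbing the cross term once more
  -- yields the stability constant.
  have e4 : δ * a ^ 2 ≤ U * D * h ^ 2 + (M + U * D) * h * a := by
    have : h * (U * b) ≤ h * (U * (D * (a + h))) := by gcongr
    linarith
  have e5 : a ^ 2 ≤ (U * D * h ^ 2 + (M + U * D) * h * a) / δ := by
    rw [le_div_iff₀ hδ]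
    linarith
  refine e5.trans (le_of_eq ?_)
  ring

end Pairing

/-! ### The Galerkin system: solvability and quasi-optimality. -/

section WellPosedness

variable {α K : ℝ} {u : ℝ × ℝ → ℝ} {s : Finset (ℤ × ℤ)} {c d : ℤ × ℤ → ℂ} {f g : ℝ × ℝ → ℂ}

theorem memLp_continuous_mul {q : ℝ × ℝ → ℝ} (hq : Continuous q)
    (hf : MemLp f 2 (volume.restrict Ω)) :
    MemLp (fun x => (q x : ℂ) * f x) 2 (volume.restrict Ω) := by
  obtain ⟨B, hB⟩ := isCompact_Ω.exists_bound_of_continuousOn hq.continuousOn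
  refine hf.of_le_mul (c := B) ((Complex.continuous_ofReal.comp hq).aestronglyMeasurable.mul hf.1)
    ((ae_restrict_iff' measurableSet_Ω).2 (Filter.Eventually.of_forall fun x hx => ?_))
  rw [norm_mul, Complex.norm_real]
  exact mul_le_mul_of_nonneg_right (hB x hx) (norm_nonneg _)

theorem ip_real_mul_right (q : ℝ × ℝ → ℝ) (f g : ℝ × ℝ → ℂ) :
    ip f (fun x => (q x : ℂ) * g x) = ip (fun x => (q x : ℂ) * f x) g := by
  simp only [ip]
  congr 1
  ext x
  rw [map_mul, Complex.conj_ofReal]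
  ring

/-- The coefficient of `conj d(k)` in the pairing of `f` with `∑ d(k) exp (i k · x)`. -/
noncomputable def galerkinCoef (α K : ℝ) (u : ℝ × ℝ → ℝ) (f : ℝ × ℝ → ℂ) (k : ℤ × ℤ) : ℂ :=
  (2 * (Real.pi : ℂ)) ^ 2 * ((K : ℂ) * fourierCoef f k
    - fourierCoef (fun x => ((dx1 u x : ℝ) : ℂ) * f x) k
    + Complex.I * (k.1 : ℂ) * fourierCoef (fun x => (u x : ℂ) * f x) k
    - ((freqNorm k ^ α : ℝ) : ℂ) * (Complex.I * (k.1 : ℂ)) * fourierCoef f k)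

/-- The real factors `u` and `∂₁u` move onto `f`, and conjugating `i k₁` flips the signs. The
pairing becomes a finite sum whose coefficients are linear in `f`, so the projection is a linear
system. -/
theorem pairing_trig_right (hu : ContDiff ℝ 1 u) (hf : MemLp f 2 (volume.restrict Ω)) :
    pairing α K u f (trig s d) = ∑ k ∈ s, galerkinCoef α K u f k * (starRingEnd ℂ) (d k) := by
  have hv : ContDiff ℝ 1 (trig s d) := contDiff_trig s d
  have hcv := hv.continuous
  have hcu := hu.continuous
  have hcdv := continuous_dx1 hv
  have hcdu := continuous_dx1 hu
  rw [pairing, dx1_ofReal_mul hu hv, ip_add_right hf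
    (memLp_of_continuous (by fun_prop) 2) (memLp_of_continuous (by fun_prop) 2),
    ip_real_mul_right, ip_real_mul_right, dx1_trig, fracLap_trig,
    ip_trig_right _ _ hf, ip_trig_right _ _ hf, ip_trig_right _ _ (memLp_continuous_mul hcdu hf),
    ip_trig_right _ _ (memLp_continuous_mul hcu hf)]
  simp only [Finset.mul_sum, ← Finset.sum_add_distrib, ← Finset.sum_sub_distrib]
  refine Finset.sum_congr rfl fun k _ => ?_
  simp only [map_mul, Complex.conj_ofReal, Complex.conj_I, map_intCast, galerkinCoef]
  ring

theorem galerkinCoef_add (hu : ContDiff ℝ 1 u) (hf : MemLp f 2 (volume.restrict Ω))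
    (hg : MemLp g 2 (volume.restrict Ω)) (k : ℤ × ℤ) :
    galerkinCoef α K u (f + g) k = galerkinCoef α K u f k + galerkinCoef α K u g k := by
  have h1 : ∀ q : ℝ × ℝ → ℝ, Continuous q → fourierCoef (fun x => (q x : ℂ) * (f + g) x) k =
      fourierCoef (fun x => (q x : ℂ) * f x) k + fourierCoef (fun x => (q x : ℂ) * g x) k := by
    intro q hq
    rw [← fourierCoef_add (memLp_continuous_mul hq hf) (memLp_continuous_mul hq hg)]
    congr 1
    ext x
    simp [mul_add]
  rw [galerkinCoef, fourierCoef_add hf hg, h1 _ hu.continuous, h1 _ (continuous_dx1 hu)]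
  simp only [galerkinCoef]
  ring

theorem fourierCoef_smul (a : ℂ) (f : ℝ × ℝ → ℂ) (k : ℤ × ℤ) :
    fourierCoef (a • f) k = a * fourierCoef f k := by
  rw [fourierCoef_eq_ip, ip_smul_left, fourierCoef_eq_ip]
  ring

theorem galerkinCoef_smul (a : ℂ) (k : ℤ × ℤ) :
    galerkinCoef α K u (a • f) k = a * galerkinCoef α K u f k := by
  have h1 : ∀ q : ℝ × ℝ → ℝ, fourierCoef (fun x => (q x : ℂ) * (a • f) x) k =
      a * fourierCoef (fun x => (q x : ℂ) * f x) k := by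
    intro q
    rw [← fourierCoef_smul]
    congr 1
    ext x
    simp only [Pi.smul_apply, smul_eq_mul]
    ring
  rw [galerkinCoef, fourierCoef_smul, h1, h1]
  simp only [galerkinCoef]
  ring

theorem galerkinCoef_sub (hu : ContDiff ℝ 1 u) (hf : MemLp f 2 (volume.restrict Ω))
    (hg : MemLp g 2 (volume.restrict Ω)) (k : ℤ × ℤ) :
    galerkinCoef α K u (f - g) k = galerkinCoef α K u f k - galerkinCoef α K u g k := by
  have h : f - g = f + (-1 : ℂ) • g := by
    ext x
    simp [sub_eq_add_neg]
  rw [h, galerkinCoef_add hu hf (hg.const_smul _), galerkinCoef_smul]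
  ring

theorem forall_pairing_trig_eq_zero_iff (hu : ContDiff ℝ 1 u)
    (hf : MemLp f 2 (volume.restrict Ω)) :
    (∀ d, pairing α K u f (trig s d) = 0) ↔ ∀ k ∈ s, galerkinCoef α K u f k = 0 := by
  simp only [pairing_trig_right hu hf]
  constructor
  · intro h k hk
    simpa [Pi.single_apply, apply_ite (starRingEnd ℂ), hk] using h (Pi.single k 1)
  · intro h d
    exact Finset.sum_eq_zero fun k hk => by rw [h k hk, zero_mul]

theorem isModifiedProjection_iff (hu : ContDiff ℝ 1 u) {N : ℕ} {w φ : ℝ × ℝ → ℂ}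
    (hw : MemLp w 2 (volume.restrict Ω)) :
    IsModifiedProjection α K u N w φ ↔ ∃ c, φ = trig (box N) c ∧
      ∀ k ∈ box N, galerkinCoef α K u (trig (box N) c) k = galerkinCoef α K u w k := by
  have key : ∀ c, (∀ v ∈ trigSpace N, pairing α K u (trig (box N) c - w) v = 0) ↔
      ∀ k ∈ box N, galerkinCoef α K u (trig (box N) c) k = galerkinCoef α K u w k := by
    intro c
    simp only [mem_trigSpace, forall_exists_index]
    rw [forall_comm]
    simp only [forall_eq]
    rw [forall_pairing_trig_eq_zero_iff hu ((memLp_trig _ _).sub hw)]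
    simp only [galerkinCoef_sub hu (memLp_trig _ _) hw, sub_eq_zero]
  constructor
  · rintro ⟨h1, h2⟩
    obtain ⟨c, rfl⟩ := mem_trigSpace.1 h1
    exact ⟨c, rfl, (key c).1 h2⟩
  · rintro ⟨c, rfl, h⟩
    exact ⟨mem_trigSpace.2 ⟨c, rfl⟩, (key c).2 h⟩

theorem trig_congr (h : ∀ k ∈ s, c k = d k) : trig s c = trig s d := by
  ext x
  exact Finset.sum_congr rfl fun k hk => by rw [h k hk]

/-- Stability with zero truncation error makes the kernel trivial. -/
theorem coef_eq_zero_of_galerkinCoef_eq_zero (hα : 1 ≤ α) (hu : ContDiff ℝ 1 u)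
    (hup : IsPeriodic u) (hK : (1 / 2 : ℝ) * (⨆ x : ℝ × ℝ, |dx1 u x|) < K)
    (h : ∀ k ∈ s, galerkinCoef α K u (trig s c) k = 0) : ∀ k ∈ s, c k = 0 := by
  obtain ⟨C, -, hC⟩ := exists_stability_const hα hu hup hK
  have h0 : MemLp (0 : ℝ × ℝ → ℂ) 2 (volume.restrict Ω) := MemLp.zero'
  have hz : ∀ k, fourierCoef 0 k = 0 := fun k => by simp [fourierCoef]
  have h1 := hC s c 0 h0 (fun k _ => hz k) (by
    rw [sub_zero]
    exact (forall_pairing_trig_eq_zero_iff hu (memLp_trig s c)).2 h)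
  have h2 : l2Norm (0 : ℝ × ℝ → ℂ) = 0 := by simp [l2Norm]
  rw [h2, mul_zero] at h1
  have h3 : l2Norm (trig s c) ^ 2 = 0 := by
    rw [le_antisymm h1 (l2Norm_nonneg _)]
    norm_num
  rw [l2Norm_trig_sq, mul_eq_zero, or_iff_right (by simp [Real.pi_ne_zero]),
    Finset.sum_eq_zero_iff_of_nonneg fun k _ => by positivity] at h3
  intro k hk
  simpa using h3 k hk

/-- There are as many equations as unknowns, and an injective endomorphism of a finite-dimensional
space is surjective. -/
theorem exists_galerkinCoef_eq (hα : 1 ≤ α) (hu : ContDiff ℝ 1 u)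
    (hup : IsPeriodic u) (hK : (1 / 2 : ℝ) * (⨆ x : ℝ × ℝ, |dx1 u x|) < K)
    (s : Finset (ℤ × ℤ)) (b : ℤ × ℤ → ℂ) :
    ∃ c, ∀ k ∈ s, galerkinCoef α K u (trig s c) k = b k := by
  let T : (s → ℂ) →ₗ[ℂ] (s → ℂ) :=
    { toFun := fun c k => galerkinCoef α K u
        (trig s (Function.ExtendByZero.linearMap ℂ ((↑) : s → ℤ × ℤ) c)) k
      map_add' := fun c d => by
        ext k
        rw [Pi.add_apply, ← galerkinCoef_add hu (memLp_trig _ _) (memLp_trig _ _), map_add]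
        congr 1
        ext x
        simp [trig, add_mul, Finset.sum_add_distrib]
      map_smul' := fun a c => by
        ext k
        rw [Pi.smul_apply, RingHom.id_apply, smul_eq_mul, ← galerkinCoef_smul, map_smul]
        congr 1
        ext x
        simp [trig, Finset.mul_sum, mul_assoc] }
  have hT : Function.Injective T := by
    rw [injective_iff_map_eq_zero]
    intro c hc
    have := coef_eq_zero_of_galerkinCoef_eq_zero (s := s) hα hu hup hK
      (c := Function.ExtendByZero.linearMap ℂ ((↑) : s → ℤ × ℤ) c)
      fun k hk => congrFun hc ⟨k, hk⟩
    ext k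
    rw [← Subtype.val_injective.extend_apply c 0 k]
    exact this k k.2
  obtain ⟨c, hc⟩ := LinearMap.injective_iff_surjective.1 hT fun k => b k
  exact ⟨_, fun k hk => congrFun hc ⟨k, hk⟩⟩

theorem existsUnique_isModifiedProjection (hα : 1 ≤ α) (hu : ContDiff ℝ 1 u)
    (hup : IsPeriodic u) (hK : (1 / 2 : ℝ) * (⨆ x : ℝ × ℝ, |dx1 u x|) < K) (N : ℕ)
    {w : ℝ × ℝ → ℂ} (hw : MemLp w 2 (volume.restrict Ω)) :
    ∃! φ, IsModifiedProjection α K u N w φ := by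
  simp only [isModifiedProjection_iff hu hw]
  obtain ⟨c, hc⟩ := exists_galerkinCoef_eq hα hu hup hK (box N) (galerkinCoef α K u w)
  refine ⟨trig (box N) c, ⟨c, rfl, hc⟩, ?_⟩
  rintro _ ⟨d, rfl, hd⟩
  refine trig_congr fun k hk => sub_eq_zero.1 ?_
  refine coef_eq_zero_of_galerkinCoef_eq_zero (c := d - c) hα hu hup hK (fun k hk => ?_) k hk
  rw [← trig_sub, galerkinCoef_sub hu (memLp_trig _ _) (memLp_trig _ _), hd k hk, hc k hk, sub_self]

/-- Quasi-optimality in `L²`, in terms of Fourier coefficients. -/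
theorem exists_quasi_optimality_const (hα : 1 ≤ α) (hu : ContDiff ℝ 1 u)
    (hup : IsPeriodic u) (hK : (1 / 2 : ℝ) * (⨆ x : ℝ × ℝ, |dx1 u x|) < K) :
    ∃ C : ℝ, 0 ≤ C ∧ ∀ (N : ℕ) (w φ : ℝ × ℝ → ℂ), MemLp w 2 (volume.restrict Ω) →
      IsModifiedProjection α K u N w φ → ∃ c, φ = trig (box N) c ∧
        ∑ k ∈ box N, ‖fourierCoef (w - φ) k‖ ^ 2 ≤
          C * ∑' k, if k ∈ box N then 0 else ‖fourierCoef w k‖ ^ 2 := by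
  obtain ⟨C, hC0, hC⟩ := exists_stability_const hα hu hup hK
  refine ⟨C ^ 2, by positivity, fun N w φ hw hφ => ?_⟩
  obtain ⟨c, rfl, hc⟩ := (isModifiedProjection_iff hu hw).1 hφ
  refine ⟨c, rfl, ?_⟩
  set P := trig (box N) (fourierCoef w) with hP
  have hPm : MemLp P 2 (volume.restrict Ω) := memLp_trig _ _
  have hcoef : ∀ k, fourierCoef (w - P) k = if k ∈ box N then 0 else fourierCoef w k := by
    intro k
    rw [fourierCoef_sub hw hPm, hP, fourierCoef_trig]
    split_ifs <;> simp
  -- Stability for `θ = φ - P` and `f = w - P`; their difference is `φ - w`, which satisfies the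
  -- Galerkin equations.
  have h1 := hC (box N) (c - fourierCoef w) (w - P) (hw.sub hPm)
    (fun k hk => by rw [hcoef, if_pos hk])
    (by
      rw [← trig_sub, ← hP, sub_sub_sub_cancel_right,
        forall_pairing_trig_eq_zero_iff hu ((memLp_trig _ _).sub hw)]
      intro k hk
      rw [galerkinCoef_sub hu (memLp_trig _ _) hw, hc k hk, sub_self])
  have h2 := pow_le_pow_left₀ (l2Norm_nonneg _) h1 2
  rw [mul_pow, l2Norm_trig_sq, l2Norm_sq_eq_tsum (hw.sub hPm), mul_left_comm] at h2
  have h3 := le_of_mul_le_mul_left h2 (by have := Real.pi_pos; positivity)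
  have h4 : (fun k => ‖fourierCoef (w - P) k‖ ^ 2) =
      fun k => if k ∈ box N then 0 else ‖fourierCoef w k‖ ^ 2 := by
    ext k
    rw [hcoef]
    split_ifs <;> simp
  rw [h4] at h3
  refine le_trans (le_of_eq ?_) h3
  refine Finset.sum_congr rfl fun k hk => ?_
  rw [fourierCoef_sub hw (memLp_trig _ _), fourierCoef_trig, if_pos hk, norm_sub_rev]
  rfl

end WellPosedness

/-! ### Algebraic convergence in Sobolev norms. -/

theorem freqNorm_nonneg (k : ℤ × ℤ) : 0 ≤ freqNorm k := Real.sqrt_nonneg _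

theorem freqNorm_sq (k : ℤ × ℤ) : freqNorm k ^ 2 = (k.1 : ℝ) ^ 2 + (k.2 : ℝ) ^ 2 :=
  Real.sq_sqrt (by positivity)

theorem one_add_freqNorm_sq_le {N : ℕ} (hN : 1 ≤ N) {k : ℤ × ℤ} (hk : k ∈ box N) :
    1 + freqNorm k ^ 2 ≤ 3 * (N : ℝ) ^ 2 := by
  rw [mem_box, max_le_iff] at hk
  have h1 : |(k.1 : ℝ)| ≤ N := by exact_mod_cast hk.1
  have h2 : |(k.2 : ℝ)| ≤ N := by exact_mod_cast hk.2
  have h3 : (1 : ℝ) ≤ N := by exact_mod_cast hN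
  rw [freqNorm_sq]
  nlinarith [sq_abs (k.1 : ℝ), sq_abs (k.2 : ℝ), abs_nonneg (k.1 : ℝ), abs_nonneg (k.2 : ℝ)]

theorem le_freqNorm {N : ℕ} {k : ℤ × ℤ} (hk : k ∉ box N) : (N : ℝ) ≤ freqNorm k := by
  rw [mem_box, max_le_iff, not_and_or, not_le, not_le] at hk
  rcases hk with h | h
  · have h1 : (N : ℝ) ≤ |(k.1 : ℝ)| := by exact_mod_cast h.le
    exact h1.trans (Real.abs_le_sqrt (by nlinarith [sq_nonneg (k.2 : ℝ)]))
  · have h1 : (N : ℝ) ≤ |(k.2 : ℝ)| := by exact_mod_cast h.le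
    exact h1.trans (Real.abs_le_sqrt (by nlinarith [sq_nonneg (k.1 : ℝ)]))

/-- Outside the box `|k| ≥ N > 0`, and the surplus power `|k|^{2(l - r)}` has nonpositive exponent.
-/
theorem rpow_freqNorm_le {N : ℕ} (hN : 1 ≤ N) {k : ℤ × ℤ} (hk : k ∉ box N) {l r : ℝ}
    (hlr : l ≤ r) :
    freqNorm k ^ (2 * l) ≤ (N : ℝ) ^ (2 * (l - r)) * freqNorm k ^ (2 * r) := by
  have h0 : (0 : ℝ) < N := by exact_mod_cast hN
  have h1 := le_freqNorm hk
  have h2 : 2 * l = 2 * (l - r) + 2 * r := by ring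
  rw [h2, Real.rpow_add (h0.trans_le h1)]
  exact mul_le_mul_of_nonneg_right (Real.rpow_le_rpow_of_nonpos h0 h1 (by linarith))
    (Real.rpow_nonneg (freqNorm_nonneg k) _)

theorem mul_sq_rpow {a x l : ℝ} (ha : 0 ≤ a) (hx : 0 ≤ x) :
    (a * x ^ 2) ^ l = a ^ l * x ^ (2 * l) := by
  rw [Real.mul_rpow ha (by positivity), ← Real.rpow_natCast, ← Real.rpow_mul hx]
  norm_num

theorem one_add_freqNorm_sq_rpow_le {N : ℕ} (hN : 1 ≤ N) {k : ℤ × ℤ} (hk : k ∉ box N) {l r : ℝ}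
    (hl : 0 ≤ l) (hlr : l ≤ r) :
    (1 + freqNorm k ^ 2) ^ l ≤ 3 ^ l * ((N : ℝ) ^ (2 * (l - r)) * freqNorm k ^ (2 * r)) := by
  have h1 : 1 ≤ freqNorm k := le_trans (by exact_mod_cast hN) (le_freqNorm hk)
  calc (1 + freqNorm k ^ 2) ^ l ≤ (3 * freqNorm k ^ 2) ^ l :=
        Real.rpow_le_rpow (by positivity) (by nlinarith) hl
    _ = 3 ^ l * freqNorm k ^ (2 * l) := mul_sq_rpow (by norm_num) (freqNorm_nonneg k)
    _ ≤ _ := mul_le_mul_of_nonneg_left (rpow_freqNorm_le hN hk hlr) (by positivity)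

/-- Needed because the `tsum` of a non-summable family is zero, which would make the seminorm
meaningless as a bound. -/
theorem summable_seminorm {r : ℝ} (hr : 0 ≤ r) {w : ℝ × ℝ → ℂ}
    (hw : Summable fun k : ℤ × ℤ => (1 + freqNorm k ^ 2) ^ r * ‖fourierCoef w k‖ ^ 2) :
    Summable fun k : ℤ × ℤ => freqNorm k ^ (2 * r) * ‖fourierCoef w k‖ ^ 2 := by
  refine hw.of_nonneg_of_le (fun k => ?_) fun k => ?_
  · exact mul_nonneg (Real.rpow_nonneg (freqNorm_nonneg k) _) (by positivity)
  · have h := mul_sq_rpow (l := r) zero_le_one (freqNorm_nonneg k)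
    rw [Real.one_rpow, one_mul, one_mul] at h
    rw [← h]
    exact mul_le_mul_of_nonneg_right (Real.rpow_le_rpow (by positivity) (by linarith) hr)
      (by positivity)

theorem isPeriodic_sub {f g : ℝ × ℝ → ℂ} (hf : IsPeriodic f) (hg : IsPeriodic g) :
    IsPeriodic (f - g) := fun x => by
  simp [(hf x).1, (hf x).2, (hg x).1, (hg x).2]

theorem fourierCoef_sub_trig_of_notMem {s : Finset (ℤ × ℤ)} {c : ℤ × ℤ → ℂ} {w : ℝ × ℝ → ℂ}
    (hw : MemLp w 2 (volume.restrict Ω)) {k : ℤ × ℤ} (hk : k ∉ s) :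
    fourierCoef (w - trig s c) k = fourierCoef w k := by
  rw [fourierCoef_sub hw (memLp_trig s c), fourierCoef_trig, if_neg hk, sub_zero]

variable {α K : ℝ} {u : ℝ × ℝ → ℝ}

/-- Inside the box the weight costs `N^{2l}` and the squared `L²` estimate gains `N^{-2r}`. Outside
it the error has the coefficients of `w`, weighed directly against the seminorm. -/
theorem exists_algebraic_convergence_const (hα : 1 ≤ α) (hu : ContDiff ℝ 1 u)
    (hup : IsPeriodic u) (hK : (1 / 2 : ℝ) * (⨆ x : ℝ × ℝ, |dx1 u x|) < K) {r l : ℝ}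
    (hl : 0 ≤ l) (hlr : l ≤ r) :
    ∃ C : ℝ, 0 < C ∧ ∀ w : ℝ × ℝ → ℂ, MemHper r w → ∀ N : ℕ, 1 ≤ N →
      ∀ φ : ℝ × ℝ → ℂ, IsModifiedProjection α K u N w φ →
        MemHper l (w - φ) ∧
          sobolevNorm l (w - φ) ≤ C * (N : ℝ) ^ (l - r) * sobolevSeminorm r w := by
  have hr : 0 ≤ r := hl.trans hlr
  obtain ⟨C, hC0, hC⟩ := exists_quasi_optimality_const hα hu hup hK
  -- `3 ^ l` compares the weights, `C` comes from low frequencies and `1` from high ones.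
  refine ⟨Real.sqrt (3 ^ l * (C + 1)), by positivity, fun w hw N hN φ hφ => ?_⟩
  obtain ⟨hwp, hw2, hws⟩ := hw
  obtain ⟨c, rfl, hc⟩ := hC N w φ hw2 hφ
  have hN0 : (0 : ℝ) < N := by exact_mod_cast hN
  have hS := summable_seminorm hr hws
  set S := ∑' k : ℤ × ℤ, freqNorm k ^ (2 * r) * ‖fourierCoef w k‖ ^ 2 with hSdef
  have hS0 : ∀ k : ℤ × ℤ, 0 ≤ freqNorm k ^ (2 * r) * ‖fourierCoef w k‖ ^ 2 := fun k =>
    mul_nonneg (Real.rpow_nonneg (freqNorm_nonneg k) _) (by positivity)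
  set E := w - trig (box N) c with hE
  -- the truncation error
  have htail : (∑' k, if k ∈ box N then 0 else ‖fourierCoef w k‖ ^ 2) ≤
      (N : ℝ) ^ (2 * (0 - r)) * S := by
    rw [hSdef, ← tsum_mul_left]
    have hle : ∀ k : ℤ × ℤ, (if k ∈ box N then 0 else ‖fourierCoef w k‖ ^ 2) ≤
        (N : ℝ) ^ (2 * (0 - r)) * (freqNorm k ^ (2 * r) * ‖fourierCoef w k‖ ^ 2) := by
      intro k
      split_ifs with hk
      · exact mul_nonneg (by positivity) (hS0 k)
      · have := rpow_freqNorm_le hN hk hr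
        rw [mul_zero, Real.rpow_zero] at this
        rw [← mul_assoc]
        exact le_mul_of_one_le_left (by positivity) this
    refine Summable.tsum_le_tsum hle (Summable.of_nonneg_of_le (fun k => ?_) hle (hS.mul_left _))
      (hS.mul_left _)
    split_ifs <;> positivity
  -- splitting of the Sobolev norm into low and high frequencies
  set low : ℤ × ℤ → ℝ := fun k =>
    if k ∈ box N then 3 ^ l * (N : ℝ) ^ (2 * l) * ‖fourierCoef E k‖ ^ 2 else 0 with hlow
  have hlow_sum : HasSum low (∑ k ∈ box N, 3 ^ l * (N : ℝ) ^ (2 * l) * ‖fourierCoef E k‖ ^ 2) := by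
    rw [← Finset.sum_congr rfl fun k hk => if_pos (c := k ∈ box N) (e := (0 : ℝ)) hk]
    exact hasSum_sum_of_ne_finset_zero fun k hk => if_neg hk
  have hle : ∀ k : ℤ × ℤ, (1 + freqNorm k ^ 2) ^ l * ‖fourierCoef E k‖ ^ 2 ≤ low k +
      3 ^ l * (N : ℝ) ^ (2 * (l - r)) * (freqNorm k ^ (2 * r) * ‖fourierCoef w k‖ ^ 2) := by
    intro k
    by_cases hk : k ∈ box N
    · have h1 : (1 + freqNorm k ^ 2) ^ l ≤ 3 ^ l * (N : ℝ) ^ (2 * l) := by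
        rw [← mul_sq_rpow (by norm_num) hN0.le]
        exact Real.rpow_le_rpow (by positivity) (one_add_freqNorm_sq_le hN hk) hl
      simp only [hlow, if_pos hk]
      have h2 := mul_le_mul_of_nonneg_right h1 (sq_nonneg ‖fourierCoef E k‖)
      have h3 := mul_nonneg (a := 3 ^ l * (N : ℝ) ^ (2 * (l - r))) (by positivity) (hS0 k)
      linarith
    · simp only [hlow, if_neg hk]
      rw [hE, fourierCoef_sub_trig_of_notMem hw2 hk, zero_add]
      have h1 := mul_le_mul_of_nonneg_right (one_add_freqNorm_sq_rpow_le hN hk hl hlr)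
        (sq_nonneg ‖fourierCoef w k‖)
      refine h1.trans (le_of_eq (by ring))
  have hsum := (hlow_sum.summable.add (hS.mul_left (3 ^ l * (N : ℝ) ^ (2 * (l - r)))))
  have hEs : Summable fun k : ℤ × ℤ => (1 + freqNorm k ^ 2) ^ l * ‖fourierCoef E k‖ ^ 2 :=
    Summable.of_nonneg_of_le (fun k => by positivity) hle hsum
  refine ⟨⟨isPeriodic_sub hwp (isPeriodic_trig _ _), hw2.sub (memLp_trig _ _), hEs⟩, ?_⟩
  have hNr : (N : ℝ) ^ (2 * l) * (N : ℝ) ^ (2 * (0 - r)) = (N : ℝ) ^ (2 * (l - r)) := by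
    rw [← Real.rpow_add hN0]
    congr 1
    ring
  have hbound : ∑' k : ℤ × ℤ, (1 + freqNorm k ^ 2) ^ l * ‖fourierCoef E k‖ ^ 2 ≤
      3 ^ l * (C + 1) * (N : ℝ) ^ (2 * (l - r)) * S := by
    refine (hEs.tsum_le_tsum hle hsum).trans ?_
    rw [hlow_sum.summable.tsum_add (hS.mul_left _), hlow_sum.tsum_eq, tsum_mul_left,
      ← Finset.mul_sum]
    have h1 : 3 ^ l * (N : ℝ) ^ (2 * l) * ∑ k ∈ box N, ‖fourierCoef E k‖ ^ 2 ≤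
        3 ^ l * (N : ℝ) ^ (2 * l) * (C * ((N : ℝ) ^ (2 * (0 - r)) * S)) :=
      mul_le_mul_of_nonneg_left (hc.trans (mul_le_mul_of_nonneg_left htail hC0)) (by positivity)
    refine (add_le_add_left h1 _).trans (le_of_eq ?_)
    rw [← hNr]
    ring
  have hsq : (N : ℝ) ^ (2 * (l - r)) = ((N : ℝ) ^ (l - r)) ^ 2 := by
    rw [← Real.rpow_natCast, ← Real.rpow_mul hN0.le]
    congr 1
    push_cast
    ring
  rw [sobolevNorm, sobolevSeminorm, ← Real.sqrt_sq (Real.rpow_nonneg hN0.le (l - r)), ← hsq,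
    ← Real.sqrt_mul (by positivity), ← Real.sqrt_mul (by positivity)]
  exact Real.sqrt_le_sqrt hbound

/-! ### Cauchy estimates for real-analytic functions. -/

section AnalyticBounds

open scoped NNReal ENNReal Topology

variable {E F : Type*} [NormedAddCommGroup E] [NormedSpace ℝ E] [NormedAddCommGroup F]
  [NormedSpace ℝ F]

/-- The double series for recentring converges absolutely when `ρ + r` is below the radius. `T` is
its total sum at `‖y‖ = ρ`, which dominates every term for smaller `y`, uniformly in `y` and `n`. -/
theorem nnnorm_changeOrigin_mul_pow_le (p : FormalMultilinearSeries ℝ E F) {ρ r : ℝ≥0}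
    (h : (ρ + r : ℝ≥0∞) < p.radius) : ∃ T : ℝ≥0, ∀ y : E, ‖y‖₊ ≤ ρ → ∀ n : ℕ,
      ‖p.changeOrigin y n‖₊ * r ^ n ≤ T := by
  have hs := (NNReal.summable_sigma.1 (p.changeOriginSeries_summable_aux₁ h)).2
  have hρ : (ρ : ℝ≥0∞) < p.radius := lt_of_le_of_lt le_self_add h
  refine ⟨_, fun y hy n => le_trans ?_ (hs.le_tsum n fun _ _ => zero_le)⟩
  simp only [NNReal.tsum_mul_right]
  gcongr
  have hy' : (‖y‖₊ : ℝ≥0∞) < p.radius := lt_of_le_of_lt (by exact_mod_cast hy) hρ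
  refine (p.nnnorm_changeOrigin_le n hy').trans ?_
  refine (p.changeOriginSeries_summable_aux₂ hy' n).tsum_le_tsum (fun s => ?_)
    (p.changeOriginSeries_summable_aux₂ hρ n)
  gcongr

variable [CompleteSpace F] {f : E → F}

/-- Cauchy estimates near a point of analyticity, in a fixed direction of length at most one. -/
theorem exists_eventually_iteratedFDeriv_le {x : E} (hf : AnalyticAt ℝ f x) {v : E}
    (hv : ‖v‖ ≤ 1) :
    ∃ B R : ℝ, 0 ≤ B ∧ 0 < R ∧ ∀ᶠ y in 𝓝 x, ∀ n : ℕ,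
      ‖iteratedFDeriv ℝ n f y fun _ => v‖ ≤ B * n.factorial * R ^ n := by
  obtain ⟨p, r, hp⟩ := hf
  obtain ⟨q, hq0, hqr⟩ := ENNReal.lt_iff_exists_nnreal_btwn.1 hp.r_pos
  have hq0' : 0 < q := by exact_mod_cast hq0
  -- Half the radius is spent on moving the centre, half on the Cauchy estimate there.
  set ρ := q / 2 with hρ
  have hρ0 : 0 < ρ := half_pos hq0'
  have hρq : ρ + ρ = q := add_halves q
  have hρr : (ρ + ρ : ℝ≥0∞) < r := by
    rw [← ENNReal.coe_add, hρq]
    exact hqr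
  obtain ⟨T, hT⟩ := nnnorm_changeOrigin_mul_pow_le p (hρr.trans_le hp.r_le)
  refine ⟨T, (ρ : ℝ)⁻¹, T.2, by positivity, ?_⟩
  filter_upwards [Metric.ball_mem_nhds x (NNReal.coe_pos.2 hρ0)] with y hy n
  have hyx : ‖y - x‖₊ ≤ ρ := by
    rw [Metric.mem_ball, dist_eq_norm] at hy
    exact_mod_cast hy.le
  have hyr : (‖y - x‖₊ : ℝ≥0∞) < r :=
    lt_of_le_of_lt (by exact_mod_cast hyx) (lt_of_le_of_lt le_self_add hρr)
  have hpy := hp.changeOrigin hyr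
  rw [add_sub_cancel] at hpy
  rw [← hpy.factorial_smul v n]
  have h1 : ‖p.changeOrigin (y - x) n‖ * (ρ : ℝ) ^ n ≤ T := by exact_mod_cast hT (y - x) hyx n
  have h2 : ‖p.changeOrigin (y - x) n fun _ => v‖ ≤ ‖p.changeOrigin (y - x) n‖ := by
    refine ((p.changeOrigin (y - x) n).le_opNorm _).trans (mul_le_of_le_one_right (norm_nonneg _) ?_)
    simpa using pow_le_one₀ (norm_nonneg v) hv
  have h3 : ‖p.changeOrigin (y - x) n fun _ => v‖ ≤ T * (ρ : ℝ)⁻¹ ^ n := by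
    rw [inv_pow, ← div_eq_mul_inv, le_div_iff₀ (by positivity)]
    exact (mul_le_mul_of_nonneg_right h2 (by positivity)).trans h1
  rw [← Nat.cast_smul_eq_nsmul ℝ, norm_smul, Real.norm_natCast]
  calc (n.factorial : ℝ) * _ ≤ n.factorial * (T * (ρ : ℝ)⁻¹ ^ n) := by gcongr
    _ = _ := by ring

/-- The local estimates pass to finite unions by taking maxima of the constants. -/
theorem exists_iteratedFDeriv_le_on_compact {s : Set E} (hs : IsCompact s)
    (hf : AnalyticOnNhd ℝ f s) {v : E} (hv : ‖v‖ ≤ 1) :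
    ∃ B R : ℝ, 0 ≤ B ∧ 0 < R ∧ ∀ y ∈ s, ∀ n : ℕ,
      ‖iteratedFDeriv ℝ n f y fun _ => v‖ ≤ B * n.factorial * R ^ n := by
  refine hs.induction_on (p := fun t => ∃ B R : ℝ, 0 ≤ B ∧ 0 < R ∧ ∀ y ∈ t, ∀ n : ℕ,
      ‖iteratedFDeriv ℝ n f y fun _ => v‖ ≤ B * n.factorial * R ^ n) ?_ ?_ ?_ ?_
  · exact ⟨0, 1, le_rfl, one_pos, by simp⟩
  · rintro t t' htt' ⟨B, R, hB, hR, h⟩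
    exact ⟨B, R, hB, hR, fun y hy => h y (htt' hy)⟩
  · rintro t t' ⟨B, R, hB, hR, h⟩ ⟨B', R', hB', hR', h'⟩
    refine ⟨max B B', max R R', hB.trans (le_max_left _ _), hR.trans_le (le_max_left _ _), ?_⟩
    rintro y (hy | hy) n
    · refine (h y hy n).trans ?_
      gcongr
      exacts [le_max_left _ _, le_max_left _ _]
    · refine (h' y hy n).trans ?_
      gcongr
      exacts [le_max_right _ _, le_max_right _ _]
  · intro x hx
    obtain ⟨B, R, hB, hR, h⟩ := exists_eventually_iteratedFDeriv_le (hf x hx) hv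
    exact ⟨_, mem_nhdsWithin_of_mem_nhds h, B, R, hB, hR, fun y hy => hy⟩

end AnalyticBounds

/-! ### Exponential decay of Fourier coefficients. -/

section Decay

theorem fourierCoef_dx1 {f : ℝ × ℝ → ℂ} (hf : ContDiff ℝ 1 f) (hp : IsPeriodic f) (k : ℤ × ℤ) :
    fourierCoef (dx1 f) k = Complex.I * (k.1 : ℂ) * fourierCoef f k := by
  have he : ContDiff ℝ 1 fun x => (starRingEnd ℂ) (expMode k x) :=
    Complex.conjCLE.contDiff.comp (contDiff_expMode k)
  have h0 := integral_dx1_eq_zero (hf.mul he) (fun x => by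
    simp [(hp x).1, (hp x).2, (isPeriodic_expMode k x).1, (isPeriodic_expMode k x).2])
  have h1 : ∀ x, dx1 (fun x => f x * (starRingEnd ℂ) (expMode k x)) x =
      dx1 f x * (starRingEnd ℂ) (expMode k x) -
        Complex.I * (k.1 : ℂ) * (f x * (starRingEnd ℂ) (expMode k x)) := by
    intro x
    rw [dx1_mul (hf.differentiable one_ne_zero) (he.differentiable one_ne_zero),
      dx1_conj ((contDiff_expMode k (n := 1)).differentiable one_ne_zero), dx1_expMode]
    simp only [map_mul, Complex.conj_I, map_intCast]
    ring
  have hi : ip (dx1 f) (expMode k) = Complex.I * (k.1 : ℂ) * ip f (expMode k) := by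
    simp only [h1] at h0
    rw [integral_sub (integrable_ip (memLp_of_continuous (continuous_dx1 hf) 2) (memLp_expMode k))
      ((integrable_ip (memLp_of_continuous hf.continuous 2) (memLp_expMode k)).const_mul _),
      integral_const_mul, sub_eq_zero] at h0
    exact h0
  rw [fourierCoef_eq_ip, hi, fourierCoef_eq_ip]
  ring

theorem l2Norm_expMode_sq (k : ℤ × ℤ) : l2Norm (expMode k) ^ 2 = (2 * Real.pi) ^ 2 := by
  have h := ip_self (expMode k)
  rw [ip_expMode_right, fourierCoef_expMode, if_pos rfl, mul_one] at h
  exact_mod_cast h.symm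

theorem norm_fourierCoef_le {f : ℝ × ℝ → ℂ} (hf : Continuous f) {B : ℝ} (hB : 0 ≤ B)
    (h : ∀ x ∈ Ω, ‖f x‖ ≤ B) (k : ℤ × ℤ) : ‖fourierCoef f k‖ ≤ B := by
  have hpi := Real.pi_pos
  have h1 : l2Norm f ≤ B * l2Norm (expMode k) :=
    l2Norm_le_mul hB (memLp_expMode k) fun x hx => by rw [norm_expMode, mul_one]; exact h x hx
  have h2 := (norm_ip_le (memLp_of_continuous hf 2) (memLp_expMode k)).trans
    (mul_le_mul_of_nonneg_right h1 (l2Norm_nonneg _))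
  rw [mul_assoc, ← sq, l2Norm_expMode_sq, ip_expMode_right, norm_mul, norm_pow, norm_mul,
    Complex.norm_real, Real.norm_of_nonneg hpi.le, Complex.norm_ofNat, mul_comm] at h2
  exact le_of_mul_le_mul_right h2 (by positivity)

theorem dx1_iteratedFDeriv {w : ℝ × ℝ → ℂ} (hw : ContDiff ℝ ⊤ w) (n : ℕ) :
    dx1 (fun x => iteratedFDeriv ℝ n w x fun _ => ((1, 0) : ℝ × ℝ)) =
      fun x => iteratedFDeriv ℝ (n + 1) w x fun _ => ((1, 0) : ℝ × ℝ) := by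
  ext x
  have hd : DifferentiableAt ℝ (iteratedFDeriv ℝ n w) x :=
    (hw.iteratedFDeriv_right (m := 1) le_top).differentiable one_ne_zero x
  rw [iteratedFDeriv_succ_apply_left, dx1]
  have := (ContinuousMultilinearMap.apply ℝ (fun _ : Fin n => ℝ × ℝ) ℂ
    fun _ => ((1, 0) : ℝ × ℝ)).hasFDerivAt.comp x hd.hasFDerivAt
  erw [this.fderiv]
  rfl

theorem isPeriodic_iteratedFDeriv {w : ℝ × ℝ → ℂ} (hw : IsPeriodic w) (n : ℕ) :
    IsPeriodic (iteratedFDeriv ℝ n w) := by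
  intro x
  have h1 : (fun y : ℝ × ℝ => w (y + (2 * Real.pi, 0))) = w := by
    ext y
    rw [← (hw y).1]
    congr 1
    simp [Prod.ext_iff]
  have h2 : (fun y : ℝ × ℝ => w (y + (0, 2 * Real.pi))) = w := by
    ext y
    rw [← (hw y).2]
    congr 1
    simp [Prod.ext_iff]
  constructor
  · have := iteratedFDeriv_comp_add_right (𝕜 := ℝ) (f := w) n (2 * Real.pi, 0) x
    rw [h1] at this
    rw [this]
    congr 1
    simp [Prod.ext_iff]
  · have := iteratedFDeriv_comp_add_right (𝕜 := ℝ) (f := w) n (0, 2 * Real.pi) x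
    rw [h2] at this
    rw [this]
    congr 1
    simp [Prod.ext_iff]

/-- Each `x₁` derivative multiplies the coefficient by `i k₁`, so the Cauchy estimates bound `|k₁|^n
|ŵ(k)|` by `B n! R^n` for all `n`. Summing against the exponential series gives the decay. -/
theorem exists_decay_fst {w : ℝ × ℝ → ℂ} (hp : IsPeriodic w) (hw : AnalyticOnNhd ℝ w univ) :
    ∃ A σ : ℝ, 0 ≤ A ∧ 0 < σ ∧ ∀ k : ℤ × ℤ,
      ‖fourierCoef w k‖ ≤ A * Real.exp (-σ * |(k.1 : ℝ)|) := by
  have hwc : ContDiff ℝ ⊤ w := hw.contDiff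
  obtain ⟨B, R, hB, hR, hbound⟩ := exists_iteratedFDeriv_le_on_compact isCompact_Ω
    (hw.mono (subset_univ _)) (v := ((1, 0) : ℝ × ℝ)) (by simp [Prod.norm_def])
  have hD : ∀ n : ℕ, ContDiff ℝ 1 fun x => iteratedFDeriv ℝ n w x fun _ => ((1, 0) : ℝ × ℝ) :=
    fun n => (ContinuousMultilinearMap.apply ℝ (fun _ : Fin n => ℝ × ℝ) ℂ
      fun _ => ((1, 0) : ℝ × ℝ)).contDiff.comp (hwc.iteratedFDeriv_right (m := 1) le_top)
  have hDp : ∀ n : ℕ, IsPeriodic fun x => iteratedFDeriv ℝ n w x fun _ => ((1, 0) : ℝ × ℝ) :=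
    fun n x => ⟨congrArg (fun L => L fun _ => ((1, 0) : ℝ × ℝ)) (isPeriodic_iteratedFDeriv hp n x).1,
      congrArg (fun L => L fun _ => ((1, 0) : ℝ × ℝ)) (isPeriodic_iteratedFDeriv hp n x).2⟩
  have hcoef : ∀ (n : ℕ) (k : ℤ × ℤ),
      fourierCoef (fun x => iteratedFDeriv ℝ n w x fun _ => ((1, 0) : ℝ × ℝ)) k =
        (Complex.I * (k.1 : ℂ)) ^ n * fourierCoef w k := by
    intro n k
    induction n with
    | zero => simp
    | succ n ih => rw [← dx1_iteratedFDeriv hwc, fourierCoef_dx1 (hD n) (hDp n), ih]; ring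
  -- At rate `1 / (2R)` the `n`-th term is at most `B / 2^n`, with total `2B`.
  refine ⟨2 * B, (2 * R)⁻¹, by positivity, by positivity, fun k => ?_⟩
  have hn : ∀ n : ℕ, |(k.1 : ℝ)| ^ n * ‖fourierCoef w k‖ ≤ B * n.factorial * R ^ n := by
    intro n
    have := norm_fourierCoef_le (hD n).continuous (by positivity) (fun x hx => hbound x hx n) k
    rwa [hcoef, norm_mul, norm_pow, norm_mul, Complex.norm_I, one_mul, Complex.norm_intCast] at this
  have hexp : HasSum (fun n : ℕ => ‖fourierCoef w k‖ * (((2 * R)⁻¹ * |(k.1 : ℝ)|) ^ n / n.factorial))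
      (‖fourierCoef w k‖ * Real.exp ((2 * R)⁻¹ * |(k.1 : ℝ)|)) := by
    have := NormedSpace.expSeries_div_hasSum_exp (𝔸 := ℝ) ((2 * R)⁻¹ * |(k.1 : ℝ)|)
    rw [← Real.exp_eq_exp_ℝ] at this
    exact this.mul_left _
  have hgeo : HasSum (fun n : ℕ => B * (1 / 2 : ℝ) ^ n) (B * 2) := hasSum_geometric_two.mul_left B
  have hle : ‖fourierCoef w k‖ * Real.exp ((2 * R)⁻¹ * |(k.1 : ℝ)|) ≤ B * 2 := by
    refine hasSum_le (fun n => ?_) hexp hgeo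
    rw [mul_pow, inv_pow, mul_pow, mul_inv, one_div, inv_pow]
    have h2 : (0 : ℝ) < n.factorial := by exact_mod_cast n.factorial_pos
    have h3 : ‖fourierCoef w k‖ * ((((2 : ℝ) ^ n)⁻¹ * (R ^ n)⁻¹) * |(k.1 : ℝ)| ^ n / n.factorial) =
        (|(k.1 : ℝ)| ^ n * ‖fourierCoef w k‖) * (((2 : ℝ) ^ n)⁻¹ * (R ^ n)⁻¹ / n.factorial) := by
      ring
    rw [h3]
    refine (mul_le_mul_of_nonneg_right (hn n) (by positivity)).trans (le_of_eq ?_)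
    field_simp
  rw [neg_mul, Real.exp_neg, ← div_eq_mul_inv, le_div_iff₀ (Real.exp_pos _)]
  linarith

theorem fourierCoef_comp_swap (f : ℝ × ℝ → ℂ) (k : ℤ × ℤ) :
    fourierCoef (fun x => f x.swap) k.swap = fourierCoef f k := by
  simp only [fourierCoef]
  congr 1
  rw [Ω, Measure.volume_eq_prod, ← setIntegral_prod_swap]
  congr 1
  ext x
  simp only [Prod.fst_swap, Prod.snd_swap]
  rw [add_comm ((k.2 : ℂ) * _), Prod.swap_swap]

/-- Swapping the variables gives decay in `k₂` too; the larger of the two frequencies is then used.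
-/
theorem exists_decay {w : ℝ × ℝ → ℂ} (hp : IsPeriodic w) (hw : AnalyticOnNhd ℝ w univ) :
    ∃ A σ : ℝ, 0 ≤ A ∧ 0 < σ ∧ ∀ k : ℤ × ℤ,
      ‖fourierCoef w k‖ ≤ A * Real.exp (-σ * max |(k.1 : ℝ)| |(k.2 : ℝ)|) := by
  obtain ⟨A₁, σ₁, hA₁, hσ₁, h₁⟩ := exists_decay_fst hp hw
  have hswap : AnalyticOnNhd ℝ (fun x : ℝ × ℝ => w x.swap) univ := fun x _ =>
    (hw x.swap (mem_univ _)).comp (f := fun x : ℝ × ℝ => x.swap)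
      (analyticAt_snd.prod analyticAt_fst)
  obtain ⟨A₂, σ₂, hA₂, hσ₂, h₂⟩ := exists_decay_fst (w := fun x => w x.swap)
    (fun x => ⟨(hp x.swap).2, (hp x.swap).1⟩) hswap
  refine ⟨max A₁ A₂, min σ₁ σ₂, hA₁.trans (le_max_left _ _), lt_min hσ₁ hσ₂, fun k => ?_⟩
  rcases le_total |(k.2 : ℝ)| |(k.1 : ℝ)| with h | h
  · rw [max_eq_left h]
    refine (h₁ k).trans ?_
    gcongr
    exacts [le_max_left _ _, min_le_left _ _]
  · rw [max_eq_right h, ← fourierCoef_comp_swap]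
    refine (h₂ k.swap).trans ?_
    rw [Prod.fst_swap]
    gcongr
    exacts [le_max_right _ _, min_le_right _ _]

end Decay

/-! ### Truncation error and exponential convergence. -/

theorem summable_exp_neg_mul_abs_int {σ : ℝ} (hσ : 0 < σ) :
    Summable fun n : ℤ => Real.exp (-σ * |(n : ℝ)|) := by
  have h : Summable fun n : ℕ => Real.exp (-σ * (n : ℝ)) := by
    have := Real.summable_exp_nat_mul_of_ge (c := -σ) (by linarith) (f := fun n => n)
      fun n => le_rfl
    exact this
  refine Summable.of_nat_of_neg ?_ ?_ <;> simpa using h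

/-- The maximum is at least half the sum, so a product of one-dimensional series dominates. -/
theorem summable_exp_neg_mul_max {σ : ℝ} (hσ : 0 < σ) :
    Summable fun k : ℤ × ℤ => Real.exp (-σ * max |(k.1 : ℝ)| |(k.2 : ℝ)|) := by
  have h := summable_exp_neg_mul_abs_int (half_pos hσ)
  refine Summable.of_nonneg_of_le (fun _ => by positivity) (fun k => ?_)
    (h.mul_of_nonneg h (fun _ => by positivity) fun _ => by positivity)
  rw [← Real.exp_add]
  refine Real.exp_le_exp.2 ?_
  have h1 := le_max_left |(k.1 : ℝ)| |(k.2 : ℝ)|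
  have h2 := le_max_right |(k.1 : ℝ)| |(k.2 : ℝ)|
  nlinarith

theorem exists_truncation_error_le {w : ℝ × ℝ → ℂ} (hp : IsPeriodic w)
    (hw : AnalyticOnNhd ℝ w univ) :
    ∃ A σ : ℝ, 0 ≤ A ∧ 0 < σ ∧ ∀ N : ℕ,
      (∑' k, if k ∈ box N then 0 else ‖fourierCoef w k‖ ^ 2) ≤ A * Real.exp (-σ * N) := by
  obtain ⟨A, σ, hA, hσ, h⟩ := exists_decay hp hw
  have hS := summable_exp_neg_mul_max hσ
  refine ⟨A ^ 2 * ∑' k : ℤ × ℤ, Real.exp (-σ * max |(k.1 : ℝ)| |(k.2 : ℝ)|), σ,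
    mul_nonneg (by positivity) (tsum_nonneg fun _ => by positivity), hσ, fun N => ?_⟩
  -- Squaring doubles the decay rate: one half becomes `exp (-σ N)` outside the box, the other keeps
  -- the sum finite.
  have hle : ∀ k : ℤ × ℤ, (if k ∈ box N then 0 else ‖fourierCoef w k‖ ^ 2) ≤
      A ^ 2 * Real.exp (-σ * N) * Real.exp (-σ * max |(k.1 : ℝ)| |(k.2 : ℝ)|) := by
    intro k
    split_ifs with hk
    · positivity
    · have hN : (N : ℝ) ≤ max |(k.1 : ℝ)| |(k.2 : ℝ)| := by
        rw [mem_box, not_le] at hk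
        exact_mod_cast hk.le
      refine (pow_le_pow_left₀ (norm_nonneg _) (h k) 2).trans ?_
      rw [mul_pow, mul_assoc, ← Real.exp_add, ← Real.exp_nat_mul]
      refine mul_le_mul_of_nonneg_left (Real.exp_le_exp.2 ?_) (by positivity)
      push_cast
      nlinarith
  refine (Summable.tsum_le_tsum hle (Summable.of_nonneg_of_le (fun k => ?_) hle (hS.mul_left _))
    (hS.mul_left _)).trans (le_of_eq ?_)
  · split_ifs <;> positivity
  · rw [tsum_mul_left]
    ring

variable {α K : ℝ} {u : ℝ × ℝ → ℝ}

/-- By Parseval the error splits into the box, where quasi-optimality applies, and its complement,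
where it equals the tail; hence `C + 1`. -/
theorem exists_l2Norm_error_const (hα : 1 ≤ α) (hu : ContDiff ℝ 1 u)
    (hup : IsPeriodic u) (hK : (1 / 2 : ℝ) * (⨆ x : ℝ × ℝ, |dx1 u x|) < K) :
    ∃ C : ℝ, 0 ≤ C ∧ ∀ (N : ℕ) (w φ : ℝ × ℝ → ℂ), MemLp w 2 (volume.restrict Ω) →
      IsModifiedProjection α K u N w φ →
        l2Norm (w - φ) ^ 2 ≤ C * ∑' k, if k ∈ box N then 0 else ‖fourierCoef w k‖ ^ 2 := by
  obtain ⟨C, hC0, hC⟩ := exists_quasi_optimality_const hα hu hup hK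
  refine ⟨(2 * Real.pi) ^ 2 * (C + 1), by positivity, fun N w φ hw hφ => ?_⟩
  obtain ⟨c, rfl, hc⟩ := hC N w φ hw hφ
  have hE : MemLp (w - trig (box N) c) 2 (volume.restrict Ω) := hw.sub (memLp_trig _ _)
  have hs := (hasSum_sq_fourierCoef_l2Norm hE).summable
  have htail : ∀ k : {k // k ∉ box N}, ‖fourierCoef (w - trig (box N) c) k‖ ^ 2 =
      if (k : ℤ × ℤ) ∈ box N then 0 else ‖fourierCoef w k‖ ^ 2 := fun k => by
    rw [fourierCoef_sub_trig_of_notMem hw k.2, if_neg k.2]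
  have htail_sum : Summable fun k => if k ∈ box N then 0 else ‖fourierCoef w k‖ ^ 2 := by
    refine (hasSum_sq_fourierCoef_l2Norm hw).summable.of_nonneg_of_le (fun k => ?_) fun k => ?_
    · split_ifs <;> positivity
    · split_ifs
      · positivity
      · exact le_rfl
  have hsplit := hs.sum_add_tsum_subtype_compl (box N)
  have hsplit' := htail_sum.sum_add_tsum_subtype_compl (box N)
  rw [Finset.sum_eq_zero fun k hk => if_pos hk, zero_add] at hsplit'
  rw [tsum_congr htail, hsplit'] at hsplit
  rw [l2Norm_sq_eq_tsum hE, ← hsplit, mul_assoc]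
  exact mul_le_mul_of_nonneg_left (by linarith) (by positivity)

theorem exists_exponential_convergence (hα : 1 ≤ α) (hu : ContDiff ℝ 1 u)
    (hup : IsPeriodic u) (hK : (1 / 2 : ℝ) * (⨆ x : ℝ × ℝ, |dx1 u x|) < K)
    {w : ℝ × ℝ → ℂ} (hp : IsPeriodic w) (hw : AnalyticOnNhd ℝ w univ) :
    ∃ C σ : ℝ, 0 < C ∧ 0 < σ ∧ ∀ N : ℕ, 1 ≤ N →
      ∀ φ : ℝ × ℝ → ℂ, IsModifiedProjection α K u N w φ →
        l2Norm (w - φ) ≤ C * Real.exp (-σ * (N : ℝ)) * l2Norm w := by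
  have hwm : MemLp w 2 (volume.restrict Ω) := memLp_of_continuous hw.continuous 2
  obtain ⟨C, hC0, hC⟩ := exists_l2Norm_error_const hα hu hup hK
  obtain ⟨A, σ, hA0, hσ, hA⟩ := exists_truncation_error_le hp hw
  -- The constant will be divided by `‖w‖`, so `‖w‖ = 0` is separate: there all coefficients vanish
  -- and the error is zero.
  rcases (l2Norm_nonneg w).eq_or_lt with h0 | h0
  · refine ⟨1, 1, one_pos, one_pos, fun N _ φ hφ => ?_⟩
    have hs := hasSum_sq_fourierCoef_l2Norm hwm
    rw [← h0, zero_pow two_ne_zero, mul_zero, hasSum_zero_iff_of_nonneg fun _ => by positivity] at hs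
    have h1 := hC N w φ hwm hφ
    have hz : ∀ k, (if k ∈ box N then 0 else ‖fourierCoef w k‖ ^ 2) = 0 := by
      intro k
      split_ifs
      · rfl
      · exact congrFun hs k
    rw [tsum_congr hz, tsum_zero, mul_zero] at h1
    rw [← h0, mul_zero]
    exact le_of_sq_le_sq (by simpa using h1) le_rfl
  -- The rate is halved because the bound is on the squared norm; the added `1` keeps the constant
  -- positive.
  · refine ⟨(Real.sqrt (C * A) + 1) / l2Norm w, σ / 2, by positivity, half_pos hσ,
      fun N _ φ hφ => ?_⟩
    have h1 : l2Norm (w - φ) ^ 2 ≤ (Real.sqrt (C * A) * Real.exp (-(σ / 2) * N)) ^ 2 := by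
      refine (hC N w φ hwm hφ).trans ((mul_le_mul_of_nonneg_left (hA N) hC0).trans (le_of_eq ?_))
      rw [mul_pow, Real.sq_sqrt (by positivity), ← Real.exp_nat_mul, mul_assoc]
      congr 3
      push_cast
      ring
    refine (le_of_sq_le_sq h1 (by positivity)).trans ?_
    have h2 : (Real.sqrt (C * A) + 1) / l2Norm w * Real.exp (-(σ / 2) * N) * l2Norm w =
        (Real.sqrt (C * A) + 1) * Real.exp (-(σ / 2) * N) := by
      field_simp
    rw [h2]
    exact mul_le_mul_of_nonneg_right (by linarith) (Real.exp_pos _).le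

end FZK

theorem theorem4p2 (α : ℝ) (hα : α ∈ Set.Icc (1 : ℝ) 2)
    (u : ℝ × ℝ → ℝ) (hu : ContDiff ℝ 1 u) (hu_per : FZK.IsPeriodic u)
    (K : ℝ) (hK : (1 / 2 : ℝ) * (⨆ x : ℝ × ℝ, |FZK.dx1 u x|) < K) :
    -- the modified projection is well defined
    (∀ N : ℕ, 1 ≤ N → ∀ w : ℝ × ℝ → ℂ, FZK.MemHper 0 w →
      ∃! φ : ℝ × ℝ → ℂ, FZK.IsModifiedProjection α K u N w φ) ∧
    -- algebraic convergence
    (∀ r l : ℝ, 0 ≤ r → 0 ≤ l → l ≤ min r (α + 1) →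
      ∃ C : ℝ, 0 < C ∧ ∀ w : ℝ × ℝ → ℂ, FZK.MemHper r w → ∀ N : ℕ, 1 ≤ N →
        ∀ φ : ℝ × ℝ → ℂ, FZK.IsModifiedProjection α K u N w φ →
          FZK.MemHper l (w - φ) ∧
          FZK.sobolevNorm l (w - φ) ≤ C * (N : ℝ) ^ (l - r) * FZK.sobolevSeminorm r w) ∧
    -- exponential convergence
    (AnalyticOnNhd ℝ u Set.univ →
      ∀ w : ℝ × ℝ → ℂ, FZK.IsPeriodic w → AnalyticOnNhd ℝ w Set.univ →
        ∃ C σ : ℝ, 0 < C ∧ 0 < σ ∧ ∀ N : ℕ, 1 ≤ N →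
          ∀ φ : ℝ × ℝ → ℂ, FZK.IsModifiedProjection α K u N w φ →
            FZK.l2Norm (w - φ) ≤ C * Real.exp (-σ * (N : ℝ)) * FZK.l2Norm w) := by
  refine ⟨fun N _ w hw => FZK.existsUnique_isModifiedProjection hα.1 hu hu_per hK N hw.2.1,
    fun r l _ hl hlr => FZK.exists_algebraic_convergence_const hα.1 hu hu_per hK hl
      (hlr.trans (min_le_left _ _)),
    fun _ w hp hw => FZK.exists_exponential_convergence hα.1 hu hu_per hK hp hw⟩
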